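/- For $x>0$, $\alpha,\alpha',\beta,\beta',\gamma\in\mathbb C$ with $\operatorname{Re}\gamma>0$, and $f:(0,\infty)\to\mathbb C$, let $$\left(I_{0,+}^{\alpha,\alpha',\beta,\beta',\gamma}f\right)(x)=\frac{x^{-\alpha}}{\Gamma(\gamma)}\int_0^x (x-t)^{\gamma-1}\,t^{-\alpha'}\,F_3\!\left(\alpha,\alpha',\beta,\beta';\gamma;1-\tfrac tx,1-\tfrac xt\right)f(t)\,dt$$ be the left-sided Marichev–Saigo–Maeda operator. Here $F_3$ is Appell's third function, that is, the analytic continuation, along the segment from $(0,0)$ to $(\xi,\eta)$, of the double series $$F_3(a,a',b,b';d;\xi,\eta)=\sum_{m,n\ge 0}\frac{(a)_m(a')_n(b)_m(b')_n}{(d)_{m+n}\,m!\,n!}\,\xi^m\eta^n ,\qquad |\xi|<1,\ |\eta|<1 .$$ Let ${}_pF_q(a_1,\dots,a_p;b_1,\dots,b_q;z)=\sum_{k\ge 0}\frac{(a_1)_k\cdots(a_p)_k}{(b_1)_k\cdots(b_q)_k}\frac{z^k}{k!}$ be the generalized hypergeometric series, defined when no $b_j$ is zero or a negative integer. Let $\alpha,\alpha',\beta,\beta',\gamma,\rho,c\in\mathbb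 C$ and $x>0$ satisfy $\operatorname{Re}\gamma>0$ and $$\operatorname{Re}(\rho+1)>\max\{0,\operatorname{Re}(\alpha+\alpha'+\beta-\gamma),\operatorname{Re}(\alpha'-\beta')\}.$$ Put $\sigma=\rho+1$, and suppose that none of $\sigma+\beta'$, $\sigma+\gamma-\alpha-\alpha'$, $\sigma+\gamma-\alpha'-\beta$ is zero or a negative integer (equivalently, no lower parameter of the series below is). Then the integrals defining the two left-hand sides converge absolutely, and $$\left(I_{0,+}^{\alpha,\alpha',\beta,\beta',\gamma}\;t^{\rho-1}\sin(ct)\right)(x)=c\,\frac{\Gamma(\sigma)\,\Gamma(\sigma+\gamma-\alpha-\alpha'-\beta)\,\Gamma(\sigma+\beta'-\alpha')}{\Gamma(\sigma+\beta')\,\Gamma(\sigma+\gamma-\alpha-\alpha')\,\Gamma(\sigma+\gamma-\alpha'-\beta)}\;x^{\sigma-\alpha-\alpha'+\gamma-1}\;\Phi\!\left(-\frac{c^2x^2}{4}\right),$$ $$\left(I_{0,+}^{\alpha,\alpha',\beta,\beta',\gamma}\;t^{\rho-1}\sinh(ct)\right)(x)=c\,\frac{\Gamma(\sigma)\,\Gamma(\sigma+\gamma-\alpha-\alpha'-\beta)\,\Gamma(\sigma+\beta'-\alpha')}{\Gamma(\sigma+\beta')\,\Gamma(\sigma+\gamma-\alpha-\alpha')\,\Gamma(\sigma+\gamma-\alpha'-\beta)}\;x^{\sigma-\alpha-\alpha'+\gamma-1}\;\Phi\!\left(\frac{c^2x^2}{4}\right),$$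 where $$\Phi(z)={}_6F_7\!\left[\begin{array}{c}\frac{\sigma}{2},\frac{\sigma+1}{2},\frac{\sigma+\gamma-\alpha-\alpha'-\beta}{2},\frac{\sigma+\gamma-\alpha-\alpha'-\beta+1}{2},\frac{\sigma+\beta'-\alpha'}{2},\frac{\sigma+\beta'-\alpha'+1}{2};\\[2pt] \frac32,\frac{\sigma+\beta'}{2},\frac{\sigma+\beta'+1}{2},\frac{\sigma+\gamma-\alpha-\alpha'}{2},\frac{\sigma+\gamma-\alpha-\alpha'+1}{2},\frac{\sigma+\gamma-\alpha'-\beta}{2},\frac{\sigma+\gamma-\alpha'-\beta+1}{2}\end{array}\bigg|\,z\right].$$ -/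

import Mathlib

open Set Filter Topology MeasureTheory

noncomputable section

/-- The Pochhammer symbol `(a)_n = a (a + 1) ⋯ (a + n - 1)`. -/
def poch (a : ℂ) (n : ℕ) : ℂ := (ascPochhammer ℂ n).eval a

/-- The generalized hypergeometric series `_pF_q(a₁, …, a_p; b₁, …, b_q; z)`, for lists `a`, `b` of
upper and lower parameters. -/
def genHypergeometric (a b : List ℂ) (z : ℂ) : ℂ :=
  ∑' k : ℕ, (a.map fun s => poch s k).prod / ((b.map fun s => poch s k).prod * poch 1 k) * z ^ k

/-- The double power series of Appell's third function `F₃(a, a', b, b'; c; x, y)`, which converges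
for `|x| < 1` and `|y| < 1`. -/
def appellF3Series (a a' b b' c x y : ℂ) : ℂ :=
  ∑' mn : ℕ × ℕ,
    poch a mn.1 * poch a' mn.2 * poch b mn.1 * poch b' mn.2 /
      (poch c (mn.1 + mn.2) * (mn.1.factorial : ℂ) * (mn.2.factorial : ℂ)) * x ^ mn.1 * y ^ mn.2

/-- `g` continues `s ↦ F₃(a, a', b, b'; c; s x, s y)` analytically from the double series near
`s = 0` along the segment from `0` to `1`. -/
def IsAppellF3Continuation (a a' b b' c x y : ℂ) (g : ℂ → ℂ) : Prop :=
  AnalyticOnNhd ℂ g (segment ℝ (0 : ℂ) 1) ∧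
    ∀ᶠ s in 𝓝 (0 : ℂ), g s = appellF3Series a a' b b' c (s * x) (s * y)

/-- Two continuations along the segment have the same end value. -/
theorem IsAppellF3Continuation.eq_at_one {a a' b b' c x y : ℂ} {g h : ℂ → ℂ}
    (hg : IsAppellF3Continuation a a' b b' c x y g)
    (hh : IsAppellF3Continuation a a' b b' c x y h) : g 1 = h 1 := by
  refine AnalyticOnNhd.eqOn_of_preconnected_of_eventuallyEq hg.1 hh.1
    (convex_segment (0 : ℂ) 1).isPreconnected (left_mem_segment ℝ 0 1) ?_
    (right_mem_segment ℝ 0 1)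
  filter_upwards [hg.2, hh.2] with s h1 h2
  rw [h1, h2]

open Classical in
/-- Appell's third function `F₃(a, a', b, b'; c; x, y)`: the analytic continuation of its double
series along the straight segment from `(0, 0)` to `(x, y)`. In the kernel of the integral operator
below, `x ∈ (0, 1)` and `y ∈ (-∞, 0)`, so that the double series itself may diverge. -/
def appellF3 (a a' b b' c x y : ℂ) : ℂ :=
  if h : ∃ g : ℂ → ℂ, IsAppellF3Continuation a a' b b' c x y g then h.choose 1 else 0

theorem IsAppellF3Continuation.appellF3_eq {a a' b b' c x y : ℂ} {g : ℂ → ℂ}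
    (hg : IsAppellF3Continuation a a' b b' c x y g) : appellF3 a a' b b' c x y = g 1 := by
  have h : ∃ g : ℂ → ℂ, IsAppellF3Continuation a a' b b' c x y g := ⟨g, hg⟩
  rw [appellF3, dif_pos h]
  exact h.choose_spec.eq_at_one hg

/-- The integrand `(x - t)^(γ-1) t^(-α') F₃(α, α', β, β'; γ; 1 - t/x, 1 - x/t) f(t)` of the left-sided
Marichev-Saigo-Maeda operator. -/
def msmIntegrand (α α' β β' γ : ℂ) (f : ℝ → ℂ) (x t : ℝ) : ℂ :=
  ((x - t : ℝ) : ℂ) ^ (γ - 1) * (t : ℂ) ^ (-α') *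
    appellF3 α α' β β' γ ((1 - t / x : ℝ) : ℂ) ((1 - x / t : ℝ) : ℂ) * f t

/-- The left-sided Marichev-Saigo-Maeda fractional integral
`(I_{0,+}^{α, α', β, β', γ} f)(x)`. -/
def msmIntegral (α α' β β' γ : ℂ) (f : ℝ → ℂ) (x : ℝ) : ℂ :=
  (x : ℂ) ^ (-α) / Complex.Gamma γ * ∫ t in (0 : ℝ)..x, msmIntegrand α α' β β' γ f x t

/-- The closed form `c · Γ[…] · x^(σ - α - α' + γ - 1) · ₆F₇[…; 3/2, …; z]` with
`Γ[…] = Γ(σ) Γ(σ+γ-α-α'-β) Γ(σ+β'-α') / (Γ(σ+β') Γ(σ+γ-α-α') Γ(σ+γ-α'-β))`. -/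
def sineImage (α α' β β' γ σ c : ℂ) (x : ℝ) (z : ℂ) : ℂ :=
  c *
    (Complex.Gamma σ * Complex.Gamma (σ + γ - α - α' - β) * Complex.Gamma (σ + β' - α') /
      (Complex.Gamma (σ + β') * Complex.Gamma (σ + γ - α - α') *
        Complex.Gamma (σ + γ - α' - β))) *
    (x : ℂ) ^ (σ - α - α' + γ - 1) *
    genHypergeometric
      [σ / 2, (σ + 1) / 2,
        (σ + γ - α - α' - β) / 2, (σ + γ - α - α' - β + 1) / 2,
        (σ + β' - α') / 2, (σ + β' - α' + 1) / 2]
      [3 / 2,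
        (σ + β') / 2, (σ + β' + 1) / 2,
        (σ + γ - α - α') / 2, (σ + γ - α - α' + 1) / 2,
        (σ + γ - α' - β) / 2, (σ + γ - α' - β + 1) / 2] z

end

/-!
The proof rests on the fact that the kernel
`(x - t) ^ (γ - 1) t ^ (-α') F₃(…; 1 - t / x, 1 - x / t)` is, up to powers
of `x`, a function of `u = t / x` with an elementary Mellin transform.

Pfaff's transformation in the second variable of `F₃` (`tsum_pfaff`,
`appellF3Series_eq_kernelDoubleSeries`) gives `F₃(x, y) = (1 - y) ^ (-α') D(x, y / (y - 1))` with
a double power series `D` that converges on the unit bidisc. The right-hand side is analytic along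
the whole segment from `(0, 0)` to `(1 - u, 1 - 1 / u)`, hence is the continuation; at the end
point both variables of `D` equal `1 - u` and the prefactor is `u ^ α'`. So the kernel is
`(1 - u) ^ (γ - 1) H(1 - u)` with a power series `H` in one variable
(`appellF3_eq_cpow_mul_kernelSeries`).

Put `d₁ = β'`, `d₂ = γ - α - α'`, `d₃ = γ - α' - β`, `p = γ - α - α' - β`, `q = β' - α'`.
Integrating `(1 - u) ^ (γ - 1) u ^ (s - 1) H(1 - u)` term by term gives Beta integrals, and the
resulting double sum is evaluated by applying Gauss's theorem (`tsum_gaussTerm`) twice, with value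
`Γ(γ) Γ(s) Γ(s + p) Γ(s + q) / (Γ(s + d₁) Γ(s + d₂) Γ(s + d₃))`. The delicate point is absolute
convergence in the full half plane `Re s > max(0, -Re p, -Re q)`, because the defining double sum
of the coefficients of `H` may exhibit cancellation. It does not when `Re d₁` is the largest of
the `Re dᵢ` and `Re q ≤ Re p` (`exists_sum_norm_kernelTerm_le`); and one may assume this, since
the coefficients, although not their individual summands, are symmetric in `d₁, d₂, d₃` and in
`p, q`. The symmetry follows from an alternating form of the coefficients
(`kernelCoeff_eq_alternating_sum`), which is a consequence of the Chu–Vandermonde identity.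

Finally the sine is expanded into its power series; the Pochhammer symbols of even index split by
the duplication formula into the parameters of the `₆F₇`. The hyperbolic sine is the case `c * I`.
-/

/-! ### Pochhammer symbols and the coefficients of the kernel -/

theorem poch_zero (a : ℂ) : poch a 0 = 1 := by simp [poch]

theorem poch_succ (a : ℂ) (n : ℕ) : poch a (n + 1) = poch a n * (a + n) :=
  ascPochhammer_succ_eval n a

theorem poch_succ_left (a : ℂ) (n : ℕ) : poch a (n + 1) = a * poch (a + 1) n := by
  simp [poch, ascPochhammer_succ_left]

theorem poch_add (a : ℂ) (m n : ℕ) : poch a (m + n) = poch a m * poch (a + m) n := by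
  induction n with
  | zero => simp [poch_zero]
  | succ n ih => rw [← add_assoc, poch_succ, ih, poch_succ]; push_cast; ring

theorem poch_ne_zero_of_re_pos {a : ℂ} (ha : 0 < a.re) (n : ℕ) : poch a n ≠ 0 := by
  induction n with
  | zero => simp [poch_zero]
  | succ n ih =>
    rw [poch_succ]
    refine mul_ne_zero ih fun h => ?_
    have := congrArg Complex.re h
    simp at this
    have : (0 : ℝ) ≤ n := n.cast_nonneg
    linarith

/-- Also valid at the poles of the Gamma function, where Mathlib's `Gamma` vanishes. -/
theorem inv_Gamma_eq_poch_mul (s : ℂ) (n : ℕ) :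
    (Complex.Gamma s)⁻¹ = poch s n * (Complex.Gamma (s + n))⁻¹ := by
  induction n with
  | zero => simp [poch_zero]
  | succ n ih =>
    rw [ih, poch_succ, Complex.one_div_Gamma_eq_self_mul_one_div_Gamma_add_one (s + n)]
    push_cast
    rw [add_assoc s]; ring

theorem Gamma_add_nat_of_re_pos {s : ℂ} (hs : 0 < s.re) (n : ℕ) :
    Complex.Gamma (s + n) = poch s n * Complex.Gamma s := by
  have h := inv_Gamma_eq_poch_mul s n
  have h1 := Complex.Gamma_ne_zero_of_re_pos hs
  have h2 : Complex.Gamma (s + n) ≠ 0 := by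
    apply Complex.Gamma_ne_zero_of_re_pos
    simp; positivity
  field_simp at h
  linear_combination h

theorem choose_eq_of_mem_antidiagonal {n : ℕ} {ij : ℕ × ℕ}
    (h : ij ∈ Finset.HasAntidiagonal.antidiagonal n) :
    (n.choose ij.1 : ℂ) = n.factorial / (ij.1.factorial * ij.2.factorial) := by
  rw [Finset.HasAntidiagonal.mem_antidiagonal] at h
  subst h
  have h1 := Nat.add_choose_mul_factorial_mul_factorial ij.1 ij.2
  have h2 : (ij.1.factorial : ℂ) ≠ 0 := by exact_mod_cast ij.1.factorial_ne_zero
  have h3 : (ij.2.factorial : ℂ) ≠ 0 := by exact_mod_cast ij.2.factorial_ne_zero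
  field_simp
  rw [← Nat.choose_symm_add] at h1
  exact_mod_cast h1

/-- Chu–Vandermonde. -/
theorem sum_antidiagonal_poch_mul_poch (a b : ℂ) (n : ℕ) :
    ∑ ij ∈ Finset.HasAntidiagonal.antidiagonal n,
      poch a ij.1 / (ij.1.factorial : ℂ) * (poch b ij.2 / (ij.2.factorial : ℂ)) =
      poch (a + b) n / (n.factorial : ℂ) := by
  have key : ∑ ij ∈ Finset.HasAntidiagonal.antidiagonal n,
      (n.choose ij.1 : ℂ) * (poch a ij.1 * poch b ij.2) =
      poch (a + b) n := by
    induction n with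
    | zero => simp [poch_zero]
    | succ n ih =>
      rw [Finset.sum_antidiagonal_choose_succ_mul (fun i j => poch a i * poch b j),
        ← Finset.sum_add_distrib, poch_succ, ← ih, Finset.sum_mul]
      refine Finset.sum_congr rfl fun ij h => ?_
      rw [Finset.HasAntidiagonal.mem_antidiagonal] at h
      rw [← h, Nat.choose_symm_add, poch_succ, poch_succ]
      push_cast; ring
  rw [← key, Finset.sum_div]
  refine Finset.sum_congr rfl fun ij h => ?_
  have h2 : (n.factorial : ℂ) ≠ 0 := by exact_mod_cast n.factorial_ne_zero
  rw [choose_eq_of_mem_antidiagonal h]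
  field_simp

/-- Chu–Vandermonde in the form of an alternating sum. -/
theorem sum_antidiagonal_neg_one_pow_mul_poch (e f : ℂ) (n : ℕ) :
    ∑ ij ∈ Finset.HasAntidiagonal.antidiagonal n,
      (-1) ^ ij.1 * (poch f ij.1 / (ij.1.factorial : ℂ)) *
        (poch (e + ij.1) ij.2 / (ij.2.factorial : ℂ)) =
      poch (e - f) n / (n.factorial : ℂ) := by
  have key : ∀ e : ℂ, ∑ ij ∈ Finset.HasAntidiagonal.antidiagonal n,
      (n.choose ij.1 : ℂ) * ((-1) ^ ij.1 * poch f ij.1 * poch (e + ij.1) ij.2) =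
      poch (e - f) n := by
    induction n with
    | zero => simp [poch_zero]
    | succ n ih =>
      intro e
      rw [Finset.sum_antidiagonal_choose_succ_mul
          (fun i j => (-1) ^ i * poch f i * poch (e + i) j),
        ← Finset.sum_add_distrib, poch_succ_left, show e - f + 1 = e + 1 - f by ring, ← ih (e + 1),
        Finset.mul_sum]
      refine Finset.sum_congr rfl fun ij h => ?_
      rw [Finset.HasAntidiagonal.mem_antidiagonal] at h
      rw [← h, Nat.choose_symm_add, poch_succ_left, poch_succ]
      rw [show e + 1 + (ij.1 : ℂ) = e + ij.1 + 1 by ring,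
        show e + ((ij.1 + 1 : ℕ) : ℂ) = e + ij.1 + 1 by push_cast; ring]
      ring
  rw [← key, Finset.sum_div]
  refine Finset.sum_congr rfl fun ij h => ?_
  have h2 : (n.factorial : ℂ) ≠ 0 := by exact_mod_cast n.factorial_ne_zero
  rw [choose_eq_of_mem_antidiagonal h]
  field_simp

/-- The `(m, n)` coefficient of the double series of the kernel, without the factor
`1 / (γ)_{m+n}`, in terms of the parameters `d₁, d₂, d₃` and `p, q` of the Mellin transform
`Γ(γ) Γ(s) Γ(s + p) Γ(s + q) / (Γ(s + d₁) Γ(s + d₂) Γ(s + d₃))` of the kernel. In the parameters of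
the operator it is `(α)_m (β)_m (α')_n (γ - β' + m)_n / (m! n!)`. -/
noncomputable def kernelTerm (d₁ d₂ d₃ p q : ℂ) (m n : ℕ) : ℂ :=
  poch (d₃ - p) m * poch (d₂ - p) m * poch (d₁ - q) n * poch (d₂ + d₃ - p - q + m) n /
    (m.factorial * n.factorial : ℂ)

/-- The diagonal sums of `kernelTerm`. -/
noncomputable def kernelCoeff (d₁ d₂ d₃ p q : ℂ) (N : ℕ) : ℂ :=
  ∑ mn ∈ Finset.HasAntidiagonal.antidiagonal N, kernelTerm d₁ d₂ d₃ p q mn.1 mn.2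

/-- The coefficients in a form that is symmetric under `d₁ ↔ d₂` and `p ↔ q`. -/
theorem kernelCoeff_eq_alternating_sum (d₁ d₂ d₃ p q : ℂ) (N : ℕ) :
    kernelCoeff d₁ d₂ d₃ p q N = ∑ kl ∈ Finset.HasAntidiagonal.antidiagonal N,
      (-1) ^ kl.1 * poch (d₃ - p) kl.1 * poch (d₃ - q) kl.1 *
        poch (d₂ + d₃ - p - q + kl.1) kl.2 * poch (d₁ + d₃ - p - q + kl.1) kl.2 /
          (kl.1.factorial * kl.2.factorial : ℂ) := by
  symm
  set F : ℕ → ℕ → ℕ → ℂ := fun k j n =>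
    (-1) ^ k * poch (d₃ - p) (k + j) * poch (d₃ - q) k * poch (d₂ + d₃ - p - q + k) (j + n) *
      poch (d₁ - q) n / (k.factorial * j.factorial * n.factorial : ℂ) with hF
  have h1 : ∀ kl : ℕ × ℕ, (-1) ^ kl.1 * poch (d₃ - p) kl.1 * poch (d₃ - q) kl.1 *
        poch (d₂ + d₃ - p - q + kl.1) kl.2 * poch (d₁ + d₃ - p - q + kl.1) kl.2 /
          (kl.1.factorial * kl.2.factorial : ℂ) =
      ∑ jn ∈ Finset.HasAntidiagonal.antidiagonal kl.2, F kl.1 jn.1 jn.2 := by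
    intro kl
    have := sum_antidiagonal_poch_mul_poch (d₃ - p + kl.1) (d₁ - q) kl.2
    rw [show d₃ - p + kl.1 + (d₁ - q) = d₁ + d₃ - p - q + kl.1 by ring] at this
    rw [mul_div_mul_comm, ← this, Finset.mul_sum]
    refine Finset.sum_congr rfl fun jn h => ?_
    rw [Finset.HasAntidiagonal.mem_antidiagonal] at h
    rw [hF, ← h]
    simp only [poch_add (d₃ - p)]
    have h2 : (kl.1.factorial : ℂ) ≠ 0 := by exact_mod_cast kl.1.factorial_ne_zero
    field_simp
  have h2 : ∀ mn : ℕ × ℕ, kernelTerm d₁ d₂ d₃ p q mn.1 mn.2 =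
      ∑ kj ∈ Finset.HasAntidiagonal.antidiagonal mn.1, F kj.1 kj.2 mn.2 := by
    intro mn
    have := sum_antidiagonal_neg_one_pow_mul_poch (d₂ + d₃ - p - q) (d₃ - q) mn.1
    rw [show d₂ + d₃ - p - q - (d₃ - q) = d₂ - p by ring] at this
    rw [kernelTerm, show poch (d₃ - p) mn.1 * poch (d₂ - p) mn.1 * poch (d₁ - q) mn.2 *
      poch (d₂ + d₃ - p - q + mn.1) mn.2 / (mn.1.factorial * mn.2.factorial : ℂ) =
      (poch (d₃ - p) mn.1 * poch (d₁ - q) mn.2 * poch (d₂ + d₃ - p - q + mn.1) mn.2 /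
        mn.2.factorial) * (poch (d₂ - p) mn.1 / mn.1.factorial) by ring, ← this, Finset.mul_sum]
    refine Finset.sum_congr rfl fun kj h => ?_
    rw [Finset.HasAntidiagonal.mem_antidiagonal] at h
    rw [hF, ← h]
    simp only [poch_add (d₂ + d₃ - p - q + kj.1) kj.2]
    push_cast
    rw [← add_assoc (d₂ + d₃ - p - q)]
    field_simp
  simp only [kernelCoeff, h1, h2]
  rw [Finset.sum_sigma', Finset.sum_sigma']
  refine Finset.sum_nbij' (fun s => ⟨(s.1.1 + s.2.1, s.2.2), (s.1.1, s.2.1)⟩)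
    (fun s => ⟨(s.2.1, s.2.2 + s.1.2), (s.2.2, s.1.2)⟩) ?_ ?_ ?_ ?_ ?_
  · rintro ⟨⟨k, l⟩, ⟨j, n⟩⟩ h
    simp only [Finset.mem_sigma, Finset.HasAntidiagonal.mem_antidiagonal] at h ⊢
    grind
  · rintro ⟨⟨k, l⟩, ⟨j, n⟩⟩ h
    simp only [Finset.mem_sigma, Finset.HasAntidiagonal.mem_antidiagonal] at h ⊢
    grind
  · rintro ⟨⟨k, l⟩, ⟨j, n⟩⟩ h
    simp only [Finset.mem_sigma, Finset.HasAntidiagonal.mem_antidiagonal] at h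
    obtain ⟨_, rfl⟩ := h
    rfl
  · rintro ⟨⟨k, l⟩, ⟨j, n⟩⟩ h
    simp only [Finset.mem_sigma, Finset.HasAntidiagonal.mem_antidiagonal] at h
    obtain ⟨_, rfl⟩ := h
    rfl
  · rintro ⟨⟨k, l⟩, ⟨j, n⟩⟩ h
    rfl

theorem kernelCoeff_swap_d₂_d₃ (d₁ d₂ d₃ p q : ℂ) :
    kernelCoeff d₁ d₂ d₃ p q = kernelCoeff d₁ d₃ d₂ p q := by
  funext N
  refine Finset.sum_congr rfl fun mn _ => ?_
  rw [kernelTerm, kernelTerm, add_comm d₂ d₃]; ring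

theorem kernelCoeff_swap_d₁_d₂ (d₁ d₂ d₃ p q : ℂ) :
    kernelCoeff d₁ d₂ d₃ p q = kernelCoeff d₂ d₁ d₃ p q := by
  funext N
  rw [kernelCoeff_eq_alternating_sum, kernelCoeff_eq_alternating_sum]
  refine Finset.sum_congr rfl fun kl _ => ?_
  ring

theorem kernelCoeff_swap_p_q (d₁ d₂ d₃ p q : ℂ) :
    kernelCoeff d₁ d₂ d₃ p q = kernelCoeff d₁ d₂ d₃ q p := by
  funext N
  rw [kernelCoeff_eq_alternating_sum, kernelCoeff_eq_alternating_sum]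
  refine Finset.sum_congr rfl fun kl _ => ?_
  rw [sub_right_comm (d₂ + d₃), sub_right_comm (d₁ + d₃)]
  ring

/-! ### Growth of Pochhammer symbols and of the reciprocal Gamma function -/

theorem norm_one_add_mul_le_exp (w : ℂ) (t : ℝ) :
    ‖1 + w * t‖ ≤ Real.exp (t * w.re + ‖w‖ ^ 2 * t ^ 2) := by
  have h1 : ‖1 + w * t‖ ^ 2 = 1 + 2 * (t * w.re) + ‖w‖ ^ 2 * t ^ 2 := by
    rw [← Complex.normSq_eq_norm_sq, ← Complex.normSq_eq_norm_sq, Complex.normSq_apply,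
      Complex.normSq_apply]
    simp
    ring
  have h2 := Real.add_one_le_exp (2 * (t * w.re) + ‖w‖ ^ 2 * t ^ 2)
  have h3 : 0 ≤ ‖w‖ ^ 2 * t ^ 2 := by positivity
  have h4 : ‖1 + w * t‖ ^ 2 ≤ Real.exp (t * w.re + ‖w‖ ^ 2 * t ^ 2) ^ 2 := by
    rw [← Real.exp_nat_mul, h1]
    refine le_trans (by linarith) (h2.trans (Real.exp_le_exp.2 ?_))
    push_cast; linarith
  exact (abs_le_of_sq_le_sq' h4 (Real.exp_pos _).le).2

theorem abs_log_one_add_sub_self_le {t : ℝ} (ht : 0 ≤ t) : |Real.log (1 + t) - t| ≤ t ^ 2 := by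
  have h1 : Real.log (1 + t) ≤ t := by
    have := Real.log_le_sub_one_of_pos (show 0 < 1 + t by linarith)
    linarith
  have h2 : t - t ^ 2 ≤ Real.log (1 + t) := by
    have := Real.one_sub_inv_le_log_of_pos (show 0 < 1 + t by linarith)
    refine le_trans ?_ this
    rw [le_sub_iff_add_le, ← le_sub_iff_add_le', inv_le_iff_one_le_mul₀ (by linarith)]
    nlinarith [pow_nonneg ht 3]
  rw [abs_le]; constructor <;> linarith [sq_nonneg t]

/-- One factor of a Pochhammer symbol, compared with its asymptotic form. -/
theorem norm_add_natCast_le (z : ℂ) : ∃ K : ℝ, 0 ≤ K ∧ ∀ j : ℕ,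
    ‖z + j‖ ≤ (j + 1) * (((j + 2 : ℝ) / (j + 1)) ^ (z.re - 1) *
      Real.exp (K * (1 / (j + 1) ^ 2))) := by
  refine ⟨‖z - 1‖ ^ 2 + |(z - 1).re|, by positivity, fun j => ?_⟩
  have hj : (0 : ℝ) < j + 1 := by positivity
  set t : ℝ := 1 / (j + 1) with ht
  have ht0 : 0 < t := by positivity
  have h1 : z + j = (j + 1 : ℝ) * (1 + (z - 1) * (t : ℂ)) := by
    have : (j + 1 : ℂ) ≠ 0 := by exact_mod_cast hj.ne'
    rw [ht]; push_cast; field_simp; ring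
  have h2 : ((j + 2 : ℝ) / (j + 1)) = 1 + t := by rw [ht]; field_simp; ring
  have h3 : (1 : ℝ) / (j + 1) ^ 2 = t ^ 2 := by rw [ht]; field_simp
  rw [h1, norm_mul, h2, h3, Real.rpow_def_of_pos (by positivity), ← Real.exp_add]
  have h4 : ‖((j + 1 : ℝ) : ℂ)‖ = j + 1 := by rw [Complex.norm_real, Real.norm_of_nonneg hj.le]
  rw [h4]
  refine mul_le_mul_of_nonneg_left ((norm_one_add_mul_le_exp _ _).trans
    (Real.exp_le_exp.2 ?_)) hj.le
  have h5 := abs_log_one_add_sub_self_le ht0.le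
  have h6 : |(z - 1).re| * |Real.log (1 + t) - t| ≤ |(z - 1).re| * t ^ 2 :=
    mul_le_mul_of_nonneg_left h5 (abs_nonneg _)
  rw [← abs_mul] at h6
  have h7 := (abs_le.1 h6).1
  simp only [Complex.sub_re, Complex.one_re] at h7 ⊢
  linarith

/-- Comparison with the telescoping series of `1 / (x - 1 / 2) - 1 / (x + 1 / 2)`. -/
theorem sum_range_one_div_sq_le (m n : ℕ) :
    ∑ j ∈ Finset.range n, (1 : ℝ) / (((m + j : ℕ) : ℝ) + 1) ^ 2 ≤
      2 - 1 / (((m + n : ℕ) : ℝ) + 1 / 2) := by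
  induction n with
  | zero =>
    have : (1 : ℝ) / ((m : ℝ) + 1 / 2) ≤ 2 := by
      rw [div_le_iff₀ (by positivity)]; linarith [(m.cast_nonneg : (0 : ℝ) ≤ m)]
    simp only [Finset.range_zero, Finset.sum_empty, add_zero]; linarith
  | succ n ih =>
    rw [Finset.sum_range_succ]
    refine (add_le_add_left ih _).trans ?_
    push_cast
    set y : ℝ := (m : ℝ) + n with hy
    have hy0 : 0 ≤ y := by positivity
    rw [← add_assoc, ← hy]
    have h1 : 1 / (y + 1 / 2) - 1 / (y + 1 + 1 / 2) = 1 / ((y + 1 / 2) * (y + 1 + 1 / 2)) := by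
      field_simp; ring
    have h2 : 1 / (y + 1) ^ 2 ≤ 1 / ((y + 1 / 2) * (y + 1 + 1 / 2)) :=
      one_div_le_one_div_of_le (by positivity) (by nlinarith)
    linarith

/-- Growth of Pochhammer symbols, uniformly in the starting point and also when `z` is a
nonpositive integer. -/
theorem exists_norm_poch_add_le (z : ℂ) : ∃ C : ℝ, 0 < C ∧ ∀ m n : ℕ,
    ‖poch (z + m) n‖ ≤ C * (((m + n).factorial : ℝ) / m.factorial *
      (((m + n : ℕ) + 1 : ℝ) / (m + 1)) ^ (z.re - 1)) := by
  obtain ⟨K, hK, h⟩ := norm_add_natCast_le z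
  have key : ∀ m n : ℕ, ‖poch (z + m) n‖ ≤
      Real.exp (K * ∑ j ∈ Finset.range n, (1 : ℝ) / ((m + j : ℕ) + 1) ^ 2) *
      (((m + n).factorial : ℝ) / m.factorial *
      (((m + n : ℕ) + 1 : ℝ) / (m + 1)) ^ (z.re - 1)) := by
    intro m n
    induction n with
    | zero =>
      have h1 : (m.factorial : ℝ) ≠ 0 := by exact_mod_cast m.factorial_ne_zero
      have h2 : (m + 1 : ℝ) ≠ 0 := by positivity
      simp [poch_zero, div_self h1, div_self h2]
    | succ n ih =>
      rw [poch_succ, norm_mul]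
      have h1 := h (m + n)
      rw [show z + m + n = z + (m + n : ℕ) by push_cast; ring]
      refine (mul_le_mul ih h1 (norm_nonneg _) (by positivity)).trans (le_of_eq ?_)
      rw [Finset.sum_range_succ, mul_add, Real.exp_add, ← add_assoc, Nat.factorial_succ]
      have h3 : (((m + n + 1 : ℕ) + 1 : ℝ) / (m + 1)) =
          (((m + n : ℕ) + 1 : ℝ) / (m + 1)) * (((m + n : ℕ) + 2 : ℝ) / ((m + n : ℕ) + 1)) := by
        push_cast; field_simp; ring
      rw [h3, Real.mul_rpow (by positivity) (by positivity)]
      push_cast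
      ring
  refine ⟨Real.exp (K * 2), Real.exp_pos _, fun m n => (key m n).trans ?_⟩
  refine mul_le_mul_of_nonneg_right (Real.exp_le_exp.2 (mul_le_mul_of_nonneg_left ?_ hK))
    (by positivity)
  refine (sum_range_one_div_sq_le m n).trans ?_
  have : (0 : ℝ) ≤ 1 / (((m + n : ℕ) : ℝ) + 1 / 2) := by positivity
  linarith

theorem exists_norm_poch_le (z : ℂ) : ∃ C : ℝ, 0 < C ∧ ∀ n : ℕ,
    ‖poch z n‖ ≤ C * (n.factorial * (n + 1 : ℝ) ^ (z.re - 1)) := by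
  obtain ⟨C, hC, h⟩ := exists_norm_poch_add_le z
  refine ⟨C, hC, fun n => ?_⟩
  simpa using h 0 n

theorem poch_eq_prod_range (z : ℂ) (n : ℕ) : poch z n = ∏ j ∈ Finset.range n, (z + j) := by
  induction n with
  | zero => simp [poch_zero]
  | succ n ih => rw [poch_succ, ih, Finset.prod_range_succ]

theorem GammaSeq_eq_div_poch (z : ℂ) (n : ℕ) :
    Complex.GammaSeq z n = (n : ℂ) ^ z * n.factorial / poch z (n + 1) := by
  rw [Complex.GammaSeq, poch_eq_prod_range]

/-- Decay of `1 / Γ(z + n)`; at poles of `Γ` Mathlib's value `0⁻¹ = 0` is that of the entire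
function `1 / Γ`. -/
theorem exists_norm_inv_Gamma_add_nat_le (z : ℂ) : ∃ C : ℝ, 0 < C ∧ ∀ n : ℕ,
    ‖(Complex.Gamma (z + n))⁻¹‖ ≤ C * ((n + 1 : ℝ) ^ (1 - z.re) / n.factorial) := by
  -- descend from large real part by `1 / Γ(s) = s / Γ(s + 1)`
  suffices H : ∀ k : ℕ, ∀ z : ℂ, 0 < z.re + k → ∃ C : ℝ, 0 < C ∧ ∀ n : ℕ,
      ‖(Complex.Gamma (z + n))⁻¹‖ ≤ C * ((n + 1 : ℝ) ^ (1 - z.re) / n.factorial) by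
    obtain ⟨k, hk⟩ := exists_nat_gt (-z.re)
    exact H k z (by linarith)
  intro k
  induction k with
  | zero =>
    intro z hz
    simp only [Nat.cast_zero, add_zero] at hz
    have hpos : ∀ n : ℕ, 0 < (z + n).re := fun n => by simp; positivity
    have hΓ := Complex.Gamma_ne_zero_of_re_pos hz
    obtain ⟨B, hB⟩ := (Complex.GammaSeq_tendsto_Gamma z).norm.bddAbove_range
    have hB' : ∀ n : ℕ, ‖Complex.GammaSeq z n‖ ≤ B := fun n => hB ⟨n, rfl⟩
    have hB0 : 0 < B + 1 := by linarith [(norm_nonneg _).trans (hB' 0)]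
    refine ⟨(B + 1) * (‖z‖ + 1) ^ 2 * ‖(Complex.Gamma z)⁻¹‖,
      mul_pos (by positivity) (norm_pos_iff.2 (inv_ne_zero hΓ)), fun n => ?_⟩
    have hn : (0 : ℝ) < n + 1 := by positivity
    have hf : (0 : ℝ) < n.factorial := by exact_mod_cast n.factorial_pos
    have h1 : ‖z + n‖ ≤ (‖z‖ + 1) * (n + 1) := by
      refine (norm_add_le _ _).trans ?_
      rw [Complex.norm_natCast]
      nlinarith [norm_nonneg z, (n.cast_nonneg : (0 : ℝ) ≤ n)]
    have h2 : ‖z + (n + 1 : ℕ)‖ ≤ (‖z‖ + 1) * (n + 1) := by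
      refine (norm_add_le _ _).trans ?_
      rw [Complex.norm_natCast]
      push_cast
      nlinarith [norm_nonneg z, (n.cast_nonneg : (0 : ℝ) ≤ n)]
    have h3 : ‖poch z n‖⁻¹ ≤ (B + 1) * (‖z‖ + 1) ^ 2 *
        ((n + 1 : ℝ) ^ (1 - z.re) / n.factorial) := by
      have h4 : (n + 1 : ℝ) ^ z.re * ((n + 1) * n.factorial) / (‖poch z n‖ * (‖z + n‖ *
          ‖z + (n + 1 : ℕ)‖)) ≤ B + 1 := by
        refine le_trans (le_of_eq ?_) ((hB' (n + 1)).trans (by linarith))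
        rw [GammaSeq_eq_div_poch, poch_succ, poch_succ, norm_div, norm_mul, norm_mul, norm_mul,
          Complex.norm_natCast, Complex.norm_natCast_cpow_of_pos n.succ_pos, Nat.factorial_succ]
        push_cast; ring
      have hp : 0 < ‖poch z n‖ := norm_pos_iff.2 (poch_ne_zero_of_re_pos hz n)
      have h5 : 0 < ‖z + n‖ := norm_pos_iff.2 fun h => by simpa [h] using hpos n
      have h6 : 0 < ‖z + (n + 1 : ℕ)‖ :=
        norm_pos_iff.2 fun h => absurd (hpos (n + 1)) (by rw [h]; simp)
      rw [div_le_iff₀ (by positivity)] at h4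
      rw [Real.rpow_sub hn, Real.rpow_one, inv_le_iff_one_le_mul₀ hp]
      have h7 : ‖z + n‖ * ‖z + (n + 1 : ℕ)‖ ≤ (‖z‖ + 1) * (n + 1) * ((‖z‖ + 1) * (n + 1)) :=
        mul_le_mul h1 h2 h6.le (by positivity)
      have h8 := h4.trans (mul_le_mul_of_nonneg_left (mul_le_mul_of_nonneg_left h7 hp.le) hB0.le)
      have h9 : 0 < (n + 1 : ℝ) ^ z.re := by positivity
      have h10 : (n + 1 : ℝ) ^ z.re * n.factorial ≤
          (B + 1) * ‖poch z n‖ * (‖z‖ + 1) ^ 2 * (n + 1) := by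
        refine le_of_mul_le_mul_right ?_ hn
        linarith
      rw [show (B + 1) * (‖z‖ + 1) ^ 2 * ((n + 1 : ℝ) / (n + 1 : ℝ) ^ z.re / n.factorial) *
        ‖poch z n‖ = ((B + 1) * ‖poch z n‖ * (‖z‖ + 1) ^ 2 * (n + 1)) /
          ((n + 1 : ℝ) ^ z.re * n.factorial) by field_simp]
      rwa [one_le_div (by positivity)]
    rw [Gamma_add_nat_of_re_pos hz, mul_inv, norm_mul, norm_inv]
    calc ‖poch z n‖⁻¹ * ‖(Complex.Gamma z)⁻¹‖ ≤ _ :=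
          mul_le_mul_of_nonneg_right h3 (norm_nonneg _)
      _ = _ := by ring
  | succ k ih =>
    intro z hz
    obtain ⟨C, hC, h⟩ := ih (z + 1) (by simp; push_cast at hz; linarith)
    refine ⟨C * (‖z‖ + 1), by positivity, fun n => ?_⟩
    rw [Complex.one_div_Gamma_eq_self_mul_one_div_Gamma_add_one, norm_mul,
      show z + n + 1 = z + 1 + n by ring]
    have h1 : ‖z + n‖ ≤ (‖z‖ + 1) * (n + 1) := by
      refine (norm_add_le _ _).trans ?_
      rw [Complex.norm_natCast]
      nlinarith [norm_nonneg z, (n.cast_nonneg : (0 : ℝ) ≤ n)]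
    refine (mul_le_mul h1 (h n) (norm_nonneg _) (by positivity)).trans (le_of_eq ?_)
    have h2 : (n + 1 : ℝ) ^ (1 - z.re) = (n + 1) * (n + 1 : ℝ) ^ (1 - (z + 1).re) := by
      rw [Complex.add_re, Complex.one_re, show 1 - z.re = 1 + (1 - (z.re + 1)) by ring,
        Real.rpow_add (by positivity), Real.rpow_one]
    rw [h2]; ring

/-! ### Gauss's summation theorem -/

theorem summable_natCast_add_one_rpow {s : ℝ} (hs : s < -1) :
    Summable fun n : ℕ => (n + 1 : ℝ) ^ s := by
  have := (summable_nat_add_iff 1).2 (Real.summable_nat_rpow.2 hs)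
  simpa using this

theorem tendsto_natCast_add_one_rpow_zero {s : ℝ} (hs : s < 0) :
    Tendsto (fun n : ℕ => (n + 1 : ℝ) ^ s) atTop (𝓝 0) := by
  have h := (tendsto_rpow_neg_atTop (neg_pos.2 hs)).comp
    (tendsto_atTop_add_const_right atTop (1 : ℝ) tendsto_natCast_atTop_atTop)
  simpa [Function.comp_def] using h

/-- The terms of Gauss's series at `1`, divided by `Γ(c)`; they are defined for every `c`. -/
noncomputable def gaussTerm (a b c : ℂ) (n : ℕ) : ℂ :=
  poch a n * poch b n / n.factorial * (Complex.Gamma (c + n))⁻¹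

theorem exists_norm_gaussTerm_le (a b c : ℂ) : ∃ C : ℝ, 0 < C ∧ ∀ n : ℕ,
    ‖gaussTerm a b c n‖ ≤ C * (n + 1 : ℝ) ^ ((a + b - c).re - 1) := by
  obtain ⟨A, hA, ha⟩ := exists_norm_poch_le a
  obtain ⟨B, hB, hb⟩ := exists_norm_poch_le b
  obtain ⟨D, hD, hd⟩ := exists_norm_inv_Gamma_add_nat_le c
  refine ⟨A * B * D, by positivity, fun n => ?_⟩
  have hn : (0 : ℝ) < n + 1 := by positivity
  have hf : (0 : ℝ) < n.factorial := by exact_mod_cast n.factorial_pos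
  rw [gaussTerm, norm_mul, norm_div, norm_mul, Complex.norm_natCast]
  calc ‖poch a n‖ * ‖poch b n‖ / n.factorial * ‖(Complex.Gamma (c + n))⁻¹‖
      ≤ (A * (n.factorial * (n + 1 : ℝ) ^ (a.re - 1))) *
        (B * (n.factorial * (n + 1 : ℝ) ^ (b.re - 1))) / n.factorial *
        (D * ((n + 1 : ℝ) ^ (1 - c.re) / n.factorial)) := by
        gcongr
        · exact ha n
        · exact hb n
        · exact hd n
    _ = A * B * D * ((n + 1 : ℝ) ^ (a.re - 1) * (n + 1 : ℝ) ^ (b.re - 1) *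
        (n + 1 : ℝ) ^ (1 - c.re)) := by field_simp
    _ = _ := by
        rw [← Real.rpow_add hn, ← Real.rpow_add hn]
        congr 2
        simp only [Complex.add_re, Complex.sub_re]; ring

theorem summable_gaussTerm {a b c : ℂ} (h : 0 < (c - a - b).re) :
    Summable (gaussTerm a b c) := by
  obtain ⟨C, -, hC⟩ := exists_norm_gaussTerm_le a b c
  refine Summable.of_norm_bounded ((summable_natCast_add_one_rpow ?_).mul_left C) hC
  simp only [Complex.add_re, Complex.sub_re] at h ⊢
  linarith

/-- The contiguous relation of Gauss's series at `1` in the lower parameter, by telescoping. -/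
theorem tsum_gaussTerm_contiguous {a b c : ℂ} (h : 0 < (c - a - b).re) :
    (c - a - b) * ∑' n, gaussTerm a b c n =
      (c - a) * (c - b) * ∑' n, gaussTerm a b (c + 1) n := by
  have h' : 0 < (c + 1 - a - b).re := by
    simp only [Complex.add_re, Complex.sub_re, Complex.one_re] at h ⊢; linarith
  have hs : Summable fun n => (c - a - b) * gaussTerm a b c n -
      (c - a) * (c - b) * gaussTerm a b (c + 1) n :=
    ((summable_gaussTerm h).mul_left _).sub ((summable_gaussTerm h').mul_left _)
  rw [← sub_eq_zero, ← tsum_mul_left, ← tsum_mul_left,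
    ← ((summable_gaussTerm h).mul_left _).tsum_sub ((summable_gaussTerm h').mul_left _)]
  have hterm : ∀ n : ℕ, (c - a - b) * gaussTerm a b c n -
      (c - a) * (c - b) * gaussTerm a b (c + 1) n =
      n * gaussTerm a b c n - (n + 1 : ℕ) * gaussTerm a b c (n + 1) := by
    intro n
    have hf : (n.factorial : ℂ) ≠ 0 := by exact_mod_cast n.factorial_ne_zero
    have hn : (n + 1 : ℂ) ≠ 0 := by exact_mod_cast n.succ_ne_zero
    simp only [gaussTerm, poch_succ, Nat.factorial_succ]
    rw [Complex.one_div_Gamma_eq_self_mul_one_div_Gamma_add_one (c + n)]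
    rw [show c + 1 + (n : ℂ) = c + n + 1 by ring,
      show c + ((n + 1 : ℕ) : ℂ) = c + n + 1 by push_cast; ring]
    push_cast
    field_simp
    ring
  have hv : Tendsto (fun n : ℕ => (n : ℂ) * gaussTerm a b c n) atTop (𝓝 0) := by
    obtain ⟨C, hC0, hC⟩ := exists_norm_gaussTerm_le a b c
    have h0 : (a + b - c).re < 0 := by
      simp only [Complex.add_re, Complex.sub_re] at h ⊢; linarith
    refine squeeze_zero_norm (fun n => ?_)
      (by simpa using (tendsto_natCast_add_one_rpow_zero h0).const_mul C)
    have hn : (0 : ℝ) < n + 1 := by positivity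
    rw [norm_mul, Complex.norm_natCast]
    calc (n : ℝ) * ‖gaussTerm a b c n‖ ≤ (n + 1) * (C * (n + 1 : ℝ) ^ ((a + b - c).re - 1)) := by
          gcongr
          · linarith
          · exact hC n
      _ = C * (n + 1 : ℝ) ^ (a + b - c).re := by
          rw [Real.rpow_sub hn, Real.rpow_one, mul_div_assoc', mul_div_cancel₀ _ hn.ne']
  refine tendsto_nhds_unique hs.hasSum.tendsto_sum_nat ?_
  simp only [hterm]
  have : ∀ N : ℕ, ∑ n ∈ Finset.range N, ((n : ℂ) * gaussTerm a b c n -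
      (n + 1 : ℕ) * gaussTerm a b c (n + 1)) = -((N : ℂ) * gaussTerm a b c N) := by
    intro N
    rw [Finset.sum_range_sub' (fun n : ℕ => (n : ℂ) * gaussTerm a b c n)]
    simp
  simp only [this]
  simpa using hv.neg

theorem poch_mul_tsum_gaussTerm {a b c : ℂ} (h : 0 < (c - a - b).re) (k : ℕ) :
    poch (c - a - b) k * ∑' n, gaussTerm a b c n =
      poch (c - a) k * poch (c - b) k * ∑' n, gaussTerm a b (c + k) n := by
  induction k with
  | zero => simp [poch_zero]
  | succ k ih =>
    have hk : 0 < (c + k - a - b).re := by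
      have : (0 : ℝ) ≤ k := k.cast_nonneg
      simp only [Complex.add_re, Complex.sub_re, Complex.natCast_re] at h ⊢; linarith
    have := tsum_gaussTerm_contiguous hk
    rw [show c + ((k + 1 : ℕ) : ℂ) = c + k + 1 by push_cast; ring, poch_succ, poch_succ, poch_succ]
    linear_combination (c - a - b + k) * ih + poch (c - a) k * poch (c - b) k * this

/-- Valid also at the poles of `Γ`, where `GammaSeq` is eventually `0`. -/
theorem tendsto_inv_GammaSeq (s : ℂ) :
    Tendsto (fun n => (Complex.GammaSeq s n)⁻¹) atTop (𝓝 (Complex.Gamma s)⁻¹) := by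
  by_cases h : Complex.Gamma s = 0
  · obtain ⟨m, rfl⟩ := (Complex.Gamma_eq_zero_iff s).1 h
    refine Tendsto.congr' ?_ (tendsto_const_nhds (x := (0 : ℂ)) |>.trans (by rw [h, inv_zero]))
    filter_upwards [eventually_ge_atTop m] with n hn
    rw [GammaSeq_eq_div_poch, poch_eq_prod_range,
      Finset.prod_eq_zero (Finset.mem_range.2 (Nat.lt_succ_of_le hn)) (by simp)]
    simp
  · exact (Complex.GammaSeq_tendsto_Gamma s).inv₀ h

theorem poch_succ_eq_mul_inv_GammaSeq (s : ℂ) {n : ℕ} (hn : n ≠ 0) :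
    poch s (n + 1) = (n : ℂ) ^ s * n.factorial * (Complex.GammaSeq s n)⁻¹ := by
  have hf : (n.factorial : ℂ) ≠ 0 := by exact_mod_cast n.factorial_ne_zero
  have h1 : (n : ℂ) ^ s ≠ 0 := by simp [Complex.cpow_eq_zero_iff, hn]
  rw [GammaSeq_eq_div_poch, inv_div]
  field_simp

theorem norm_poch_le_norm_poch_add_nat {c : ℂ} (hc : 0 < c.re) (k n : ℕ) :
    ‖poch c n‖ ≤ ‖poch (c + k) n‖ := by
  rw [poch_eq_prod_range, poch_eq_prod_range, norm_prod, norm_prod]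
  refine Finset.prod_le_prod (fun _ _ => norm_nonneg _) fun j _ => ?_
  have hj : (0 : ℝ) ≤ j := j.cast_nonneg
  have hk : (0 : ℝ) ≤ k := k.cast_nonneg
  rw [← sq_le_sq₀ (norm_nonneg _) (norm_nonneg _), ← Complex.normSq_eq_norm_sq,
    ← Complex.normSq_eq_norm_sq, Complex.normSq_apply, Complex.normSq_apply]
  simp
  nlinarith

theorem tendsto_Gamma_mul_tsum_gaussTerm {a b c : ℂ} (hc : 0 < c.re)
    (h : 0 < (c - a - b).re) :
    Tendsto (fun k : ℕ => Complex.Gamma (c + k) * ∑' n, gaussTerm a b (c + k) n) atTop (𝓝 1) := by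
  have hck : ∀ k : ℕ, 0 < (c + k).re := fun k => by simp; positivity
  have hterm : ∀ k n : ℕ, Complex.Gamma (c + k) * gaussTerm a b (c + k) n =
      poch a n * poch b n / n.factorial * (poch (c + k) n)⁻¹ := by
    intro k n
    rw [gaussTerm, Gamma_add_nat_of_re_pos (hck k) n]
    have := Complex.Gamma_ne_zero_of_re_pos (hck k)
    have := poch_ne_zero_of_re_pos (hck k) n
    field_simp
  simp only [← tsum_mul_left, hterm]
  have h1 : ∑' n : ℕ, (if n = 0 then (1 : ℂ) else 0) = 1 := by simp
  rw [← h1]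
  have hsum := ((summable_gaussTerm h).mul_left (Complex.Gamma c)).norm
  refine tendsto_tsum_of_dominated_convergence hsum (fun n => ?_)
    (Eventually.of_forall fun k n => ?_)
  · rcases n with _ | n
    · simp [poch_zero]
    · simp only [Nat.succ_ne_zero, if_false]
      have h2 : Tendsto (fun k : ℕ => (poch (c + k) (n + 1))⁻¹) atTop (𝓝 0) := by
        rw [tendsto_zero_iff_norm_tendsto_zero]
        have hp : 0 < ‖poch (c + 1) n‖ :=
          norm_pos_iff.2 (poch_ne_zero_of_re_pos (by simpa using hck 1) n)
        have h3 : Tendsto (fun k : ℕ => ((k : ℝ) * ‖poch (c + 1) n‖)⁻¹) atTop (𝓝 0) :=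
          (tendsto_natCast_atTop_atTop.atTop_mul_const hp).inv_tendsto_atTop
        refine squeeze_zero' (Eventually.of_forall fun _ => norm_nonneg _) ?_ h3
        filter_upwards [eventually_gt_atTop 0] with k hk
        have hk' : (0 : ℝ) < k := by exact_mod_cast hk
        rw [norm_inv, poch_succ_left, norm_mul]
        refine inv_anti₀ (by positivity) (mul_le_mul ?_ ?_ (norm_nonneg _) (norm_nonneg _))
        · refine le_trans ?_ (Complex.re_le_norm _)
          simp; linarith
        · have := norm_poch_le_norm_poch_add_nat (c := c + 1) (by simpa using hck 1) k n
          rwa [add_right_comm] at this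
      simpa using h2.const_mul (poch a (n + 1) * poch b (n + 1) / (n + 1).factorial)
  · have := hterm 0 n
    simp only [Nat.cast_zero, add_zero] at this
    rw [this, norm_mul, norm_mul, norm_inv, norm_inv]
    exact mul_le_mul_of_nonneg_left (inv_anti₀ (norm_pos_iff.2 (poch_ne_zero_of_re_pos hc n))
      (norm_poch_le_norm_poch_add_nat hc k n)) (norm_nonneg _)

/-- **Gauss's summation theorem**, divided by `Γ(c)` so that it holds for every lower parameter. -/
theorem tsum_gaussTerm {a b c : ℂ} (h : 0 < (c - a - b).re) :
    ∑' n, gaussTerm a b c n =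
      Complex.Gamma (c - a - b) * (Complex.Gamma (c - a))⁻¹ * (Complex.Gamma (c - b))⁻¹ := by
  have hpos : ∀ {c : ℂ}, 0 < c.re → 0 < (c - a - b).re → ∑' n, gaussTerm a b c n =
      Complex.Gamma (c - a - b) * (Complex.Gamma (c - a))⁻¹ * (Complex.Gamma (c - b))⁻¹ := by
    intro c hc h
    have hΓ := Complex.Gamma_ne_zero_of_re_pos hc
    have hΓ' := Complex.Gamma_ne_zero_of_re_pos h
    have hl : Tendsto (fun n : ℕ => (Complex.GammaSeq (c - a) n)⁻¹ *
        (Complex.GammaSeq (c - b) n)⁻¹ * (Complex.GammaSeq c n * (Complex.Gamma c)⁻¹ *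
          (Complex.Gamma (c + (n + 1 : ℕ)) * ∑' m, gaussTerm a b (c + (n + 1 : ℕ)) m))) atTop
        (𝓝 ((Complex.Gamma (c - a))⁻¹ * (Complex.Gamma (c - b))⁻¹ *
          (Complex.Gamma c * (Complex.Gamma c)⁻¹ * 1))) :=
      ((tendsto_inv_GammaSeq _).mul (tendsto_inv_GammaSeq _)).mul
        (((Complex.GammaSeq_tendsto_Gamma c).mul_const _).mul
          ((tendsto_Gamma_mul_tsum_gaussTerm hc h).comp (tendsto_add_atTop_nat 1)))
    have hr : Tendsto (fun n : ℕ => (Complex.GammaSeq (c - a - b) n)⁻¹ *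
        ∑' m, gaussTerm a b c m) atTop
        (𝓝 ((Complex.Gamma (c - a - b))⁻¹ * ∑' m, gaussTerm a b c m)) :=
      (tendsto_inv_GammaSeq _).mul_const _
    have heq := tendsto_nhds_unique (hr.congr' ?_) hl
    · rw [mul_inv_cancel₀ hΓ, mul_one, mul_one] at heq
      field_simp at heq ⊢
      linear_combination heq
    · filter_upwards [eventually_ne_atTop 0] with n hn
      have hf : (n.factorial : ℂ) ≠ 0 := by exact_mod_cast n.factorial_ne_zero
      have hn' : (n : ℂ) ≠ 0 := by exact_mod_cast hn
      have hne : ∀ s : ℂ, (n : ℂ) ^ s ≠ 0 := fun s => by simp [Complex.cpow_eq_zero_iff, hn]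
      have h1 := poch_mul_tsum_gaussTerm h (n + 1)
      have hp := poch_ne_zero_of_re_pos hc (n + 1)
      have h2 : Complex.GammaSeq c n * poch c (n + 1) = (n : ℂ) ^ c * n.factorial := by
        rw [GammaSeq_eq_div_poch]; field_simp
      simp only [poch_succ_eq_mul_inv_GammaSeq _ hn] at h1
      rw [Gamma_add_nat_of_re_pos hc (n + 1)]
      have h3 : (n : ℂ) ^ (c - a) * (n : ℂ) ^ (c - b) = (n : ℂ) ^ (c - a - b) * (n : ℂ) ^ c := by
        rw [← Complex.cpow_add _ _ hn', ← Complex.cpow_add _ _ hn']; congr 1; ring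
      set T := ∑' m, gaussTerm a b (c + (n + 1 : ℕ)) m
      have h4 : Complex.GammaSeq c n * (Complex.Gamma c)⁻¹ *
          (poch c (n + 1) * Complex.Gamma c * T) = (n : ℂ) ^ c * n.factorial * T := by
        rw [← h2]; field_simp
      rw [h4]
      refine mul_left_cancel₀ (mul_ne_zero (hne (c - a - b)) hf) ?_
      linear_combination h1 + (n.factorial : ℂ) ^ 2 * (Complex.GammaSeq (c - a) n)⁻¹ *
        (Complex.GammaSeq (c - b) n)⁻¹ * T * h3
  obtain ⟨k, hk⟩ := exists_nat_gt (-c.re)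
  have h0 : (0 : ℝ) ≤ k := k.cast_nonneg
  have h1 := poch_mul_tsum_gaussTerm h k
  have h' : 0 < (c + k - a - b).re := by
    simp only [Complex.add_re, Complex.sub_re, Complex.natCast_re] at h ⊢; linarith
  rw [hpos (c := c + k) (by simp; linarith) h'] at h1
  refine mul_left_cancel₀ (poch_ne_zero_of_re_pos h k) ?_
  rw [h1, inv_Gamma_eq_poch_mul (c - a) k, inv_Gamma_eq_poch_mul (c - b) k,
    show c + k - a - b = c - a - b + k by ring, Gamma_add_nat_of_re_pos h k,
    show c + k - a = c - a + k by ring, show c + k - b = c - b + k by ring]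
  ring

/-! ### Growth and summation of the kernel coefficients -/

theorem summable_of_sum_norm_antidiagonal_le {F : ℕ × ℕ → ℂ} {B : ℕ → ℝ} (hB : Summable B)
    (h : ∀ N, ∑ mn ∈ Finset.HasAntidiagonal.antidiagonal N, ‖F mn‖ ≤ B N) : Summable F := by
  have hs : Summable fun x : (Σ N : ℕ, Finset.HasAntidiagonal.antidiagonal N) =>
      ‖F (x.2 : ℕ × ℕ)‖ := by
    rw [summable_sigma_of_nonneg fun _ => norm_nonneg _]
    refine ⟨fun N => Summable.of_finite, Summable.of_nonneg_of_le
      (fun N => tsum_nonneg fun _ => norm_nonneg _) (fun N => ?_) hB⟩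
    rw [Finset.tsum_subtype (Finset.HasAntidiagonal.antidiagonal N) fun mn => ‖F mn‖]
    exact h N
  exact (Finset.HasAntidiagonal.sigmaAntidiagonalEquivProd.summable_iff (f := F)).1 hs.of_norm

theorem HasSum.sum_antidiagonal {F : ℕ × ℕ → ℂ} {v : ℂ} (h : HasSum F v) :
    HasSum (fun N => ∑ mn ∈ Finset.HasAntidiagonal.antidiagonal N, F mn) v :=
  ((Finset.HasAntidiagonal.sigmaAntidiagonalEquivProd.hasSum_iff (f := F)).2 h).sigma
    fun N => Finset.hasSum (Finset.HasAntidiagonal.antidiagonal N) F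

theorem exists_sum_antidiagonal_inv_mul_inv_le {ε : ℝ} (hε : 0 < ε) : ∃ C : ℝ, 0 < C ∧ ∀ N : ℕ,
    ∑ mn ∈ Finset.HasAntidiagonal.antidiagonal N, ((mn.1 + 1 : ℝ)⁻¹ * (mn.2 + 1 : ℝ)⁻¹) ≤
      C * (N + 1 : ℝ) ^ (ε - 1) := by
  refine ⟨2 * (1 + 1 / ε), by positivity, fun N => ?_⟩
  have hN : (0 : ℝ) < N + 1 := by positivity
  have h1 : ∀ mn ∈ Finset.HasAntidiagonal.antidiagonal N,
      ((mn.1 + 1 : ℝ)⁻¹ * (mn.2 + 1 : ℝ)⁻¹) =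
        (N + 2 : ℝ)⁻¹ * (((mn.1 : ℝ) + 1)⁻¹ + ((mn.2 : ℝ) + 1)⁻¹) := by
    intro mn h
    rw [Finset.HasAntidiagonal.mem_antidiagonal] at h
    rw [← h]; push_cast; field_simp; ring
  have h2 : ∑ mn ∈ Finset.HasAntidiagonal.antidiagonal N, ((mn.1 : ℝ) + 1)⁻¹ =
      ((harmonic (N + 1) : ℚ) : ℝ) := by
    rw [Finset.Nat.sum_antidiagonal_eq_sum_range_succ (fun i _ => ((i : ℝ) + 1)⁻¹) N, harmonic]
    push_cast; rfl
  have h3 : ∑ mn ∈ Finset.HasAntidiagonal.antidiagonal N, ((mn.2 : ℝ) + 1)⁻¹ =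
      ((harmonic (N + 1) : ℚ) : ℝ) := by
    rw [← h2, ← Finset.Nat.sum_antidiagonal_swap]; rfl
  rw [Finset.sum_congr rfl h1, ← Finset.mul_sum, Finset.sum_add_distrib, h2, h3]
  have h4 : ((harmonic (N + 1) : ℚ) : ℝ) ≤ (1 + 1 / ε) * (N + 1 : ℝ) ^ ε := by
    refine (harmonic_le_one_add_log (N + 1)).trans ?_
    have h5 := Real.log_le_rpow_div hN.le hε
    have h6 : (1 : ℝ) ≤ (N + 1 : ℝ) ^ ε := Real.one_le_rpow (by linarith) hε.le
    push_cast
    calc 1 + Real.log (N + 1) ≤ (N + 1 : ℝ) ^ ε + (N + 1 : ℝ) ^ ε / ε := by linarith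
      _ = _ := by ring
  have h7 : (N + 2 : ℝ)⁻¹ ≤ (N + 1 : ℝ)⁻¹ := inv_anti₀ hN (by linarith)
  have h8 : (0 : ℝ) ≤ ((harmonic (N + 1) : ℚ) : ℝ) := by
    rw [← h2]; exact Finset.sum_nonneg fun _ _ => by positivity
  calc (N + 2 : ℝ)⁻¹ * (((harmonic (N + 1) : ℚ) : ℝ) + ((harmonic (N + 1) : ℚ) : ℝ))
      ≤ (N + 1 : ℝ)⁻¹ * ((1 + 1 / ε) * (N + 1 : ℝ) ^ ε + (1 + 1 / ε) * (N + 1 : ℝ) ^ ε) := by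
        gcongr
    _ = _ := by rw [Real.rpow_sub hN, Real.rpow_one]; ring

/-- When `Re q ≤ Re p`, the terms with small `m` and with small `n` both decay as the kernel
requires, so that nothing is lost by taking absolute values. -/
theorem exists_sum_norm_kernelTerm_le {d₁ d₂ d₃ p q g s : ℂ} (hg : g = d₁ + d₂ + d₃ - p - q)
    (hpq : q.re ≤ p.re) (hd : 0 < (s + d₁).re) (hq : 0 < (s + q).re) :
    ∃ θ : ℝ, 0 < θ ∧ ∃ C : ℝ, 0 < C ∧ ∀ N : ℕ,
      ∑ mn ∈ Finset.HasAntidiagonal.antidiagonal N, ‖kernelTerm d₁ d₂ d₃ p q mn.1 mn.2‖ ≤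
        C * (N.factorial * (N + 1 : ℝ) ^ ((g + s).re - 2 - θ)) := by
  obtain ⟨A₁, hA₁, h₁⟩ := exists_norm_poch_le (d₃ - p)
  obtain ⟨A₂, hA₂, h₂⟩ := exists_norm_poch_le (d₂ - p)
  obtain ⟨A₃, hA₃, h₃⟩ := exists_norm_poch_le (d₁ - q)
  obtain ⟨A₄, hA₄, h₄⟩ := exists_norm_poch_add_le (d₂ + d₃ - p - q)
  set θ : ℝ := min (s + d₁).re (s + q).re / 2 with hθ
  have hθ0 : 0 < θ := by rw [hθ]; exact half_pos (lt_min hd hq)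
  have hθ1 : 2 * θ ≤ (s + d₁).re := by rw [hθ]; linarith [min_le_left (s + d₁).re (s + q).re]
  have hθ2 : 2 * θ ≤ (s + q).re := by rw [hθ]; linarith [min_le_right (s + d₁).re (s + q).re]
  obtain ⟨B, hB, hsum⟩ := exists_sum_antidiagonal_inv_mul_inv_le hθ0
  refine ⟨θ, hθ0, A₁ * A₂ * A₃ * A₄ * B, by positivity, fun N => ?_⟩
  have hN : (0 : ℝ) < N + 1 := by positivity
  set e : ℝ := (d₂ + d₃ - p - q).re with he
  set τ : ℝ := max (d₁ - q).re 0 with hτ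
  have hterm : ∀ mn ∈ Finset.HasAntidiagonal.antidiagonal N,
      ‖kernelTerm d₁ d₂ d₃ p q mn.1 mn.2‖ ≤ A₁ * A₂ * A₃ * A₄ * (N.factorial *
        (N + 1 : ℝ) ^ (e - 1 + τ)) * ((mn.1 + 1 : ℝ)⁻¹ * (mn.2 + 1 : ℝ)⁻¹) := by
    rintro ⟨m, n⟩ hmn
    rw [Finset.HasAntidiagonal.mem_antidiagonal] at hmn
    dsimp only at hmn ⊢
    have hm : (0 : ℝ) < m + 1 := by positivity
    have hn : (0 : ℝ) < n + 1 := by positivity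
    have hmf : (0 : ℝ) < m.factorial := by exact_mod_cast m.factorial_pos
    have hnf : (0 : ℝ) < n.factorial := by exact_mod_cast n.factorial_pos
    have hm' : (m + 1 : ℝ) ^ ((q - p).re - 1) ≤ (m + 1 : ℝ)⁻¹ := by
      rw [← Real.rpow_neg_one]
      refine Real.rpow_le_rpow_of_exponent_le (by linarith [(m.cast_nonneg : (0 : ℝ) ≤ m)]) ?_
      simp only [Complex.sub_re]; linarith
    have hn' : (n + 1 : ℝ) ^ ((d₁ - q).re - 1) ≤ (N + 1 : ℝ) ^ τ * (n + 1 : ℝ)⁻¹ := by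
      rw [Real.rpow_sub hn, Real.rpow_one, div_eq_mul_inv]
      refine mul_le_mul_of_nonneg_right ?_ (by positivity)
      refine (Real.rpow_le_rpow_of_exponent_le (by linarith [(n.cast_nonneg : (0 : ℝ) ≤ n)])
        (le_max_left _ 0)).trans (Real.rpow_le_rpow hn.le ?_ (le_max_right _ _))
      have : n ≤ N := by omega
      have : (n : ℝ) ≤ N := by exact_mod_cast this
      linarith
    have h4 := h₄ m n
    rw [hmn] at h4
    rw [kernelTerm, norm_div, norm_mul, norm_mul, norm_mul, norm_mul, Complex.norm_natCast,
      Complex.norm_natCast]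
    calc ‖poch (d₃ - p) m‖ * ‖poch (d₂ - p) m‖ * ‖poch (d₁ - q) n‖ *
          ‖poch (d₂ + d₃ - p - q + m) n‖ / (m.factorial * n.factorial)
        ≤ (A₁ * (m.factorial * (m + 1 : ℝ) ^ ((d₃ - p).re - 1))) *
          (A₂ * (m.factorial * (m + 1 : ℝ) ^ ((d₂ - p).re - 1))) *
          (A₃ * (n.factorial * (n + 1 : ℝ) ^ ((d₁ - q).re - 1))) *
          (A₄ * ((N.factorial : ℝ) / m.factorial * ((N + 1 : ℝ) / (m + 1)) ^ (e - 1))) /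
          (m.factorial * n.factorial) := by
          gcongr
          · exact h₁ m
          · exact h₂ m
          · exact h₃ n
      _ = A₁ * A₂ * A₃ * A₄ * (N.factorial * (N + 1 : ℝ) ^ (e - 1)) *
          (((m + 1 : ℝ) ^ ((d₃ - p).re - 1) * (m + 1 : ℝ) ^ ((d₂ - p).re - 1) /
            (m + 1 : ℝ) ^ (e - 1)) * (n + 1 : ℝ) ^ ((d₁ - q).re - 1)) := by
          rw [Real.div_rpow hN.le hm.le]
          field_simp
      _ = A₁ * A₂ * A₃ * A₄ * (N.factorial * (N + 1 : ℝ) ^ (e - 1)) *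
          ((m + 1 : ℝ) ^ ((q - p).re - 1) * (n + 1 : ℝ) ^ ((d₁ - q).re - 1)) := by
          rw [← Real.rpow_add hm, ← Real.rpow_sub hm,
            show (d₃ - p).re - 1 + ((d₂ - p).re - 1) - (e - 1) = (q - p).re - 1 by
              rw [he]; simp only [Complex.add_re, Complex.sub_re]; ring]
      _ ≤ A₁ * A₂ * A₃ * A₄ * (N.factorial * (N + 1 : ℝ) ^ (e - 1)) *
          ((m + 1 : ℝ)⁻¹ * ((N + 1 : ℝ) ^ τ * (n + 1 : ℝ)⁻¹)) := by
          gcongr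
      _ = _ := by rw [Real.rpow_add hN]; ring
  refine (Finset.sum_le_sum hterm).trans ?_
  rw [← Finset.mul_sum]
  calc A₁ * A₂ * A₃ * A₄ * (N.factorial * (N + 1 : ℝ) ^ (e - 1 + τ)) * _
      ≤ A₁ * A₂ * A₃ * A₄ * (N.factorial * (N + 1 : ℝ) ^ (e - 1 + τ)) *
        (B * (N + 1 : ℝ) ^ (θ - 1)) := by
        gcongr
        exact hsum N
    _ = A₁ * A₂ * A₃ * A₄ * B * (N.factorial * (N + 1 : ℝ) ^ (e - 1 + τ + (θ - 1))) := by
        rw [Real.rpow_add hN _ (θ - 1)]; ring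
    _ ≤ _ := by
        gcongr
        · linarith [(N.cast_nonneg : (0 : ℝ) ≤ N)]
        · rcases max_cases (d₁ - q).re 0 with ⟨h, -⟩ | ⟨h, -⟩ <;>
          · rw [hτ, h, he, hg]
            simp only [Complex.add_re, Complex.sub_re] at hθ1 hθ2 ⊢
            linarith

theorem norm_kernelCoeff_le (d₁ d₂ d₃ p q : ℂ) (N : ℕ) : ‖kernelCoeff d₁ d₂ d₃ p q N‖ ≤
    ∑ mn ∈ Finset.HasAntidiagonal.antidiagonal N, ‖kernelTerm d₁ d₂ d₃ p q mn.1 mn.2‖ :=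
  norm_sum_le _ _

/-- Two applications of Gauss's theorem, under the hypotheses that make the double series converge
absolutely. -/
theorem hasSum_kernelCoeff_mul_inv_Gamma_of_le {d₁ d₂ d₃ p q g s : ℂ}
    (hg : g = d₁ + d₂ + d₃ - p - q) (hpq : q.re ≤ p.re) (hd : 0 < (s + d₁).re)
    (hq : 0 < (s + q).re) :
    HasSum (fun N : ℕ => kernelCoeff d₁ d₂ d₃ p q N * (Complex.Gamma (g + s + N))⁻¹)
      (Complex.Gamma (s + p) * Complex.Gamma (s + q) * ((Complex.Gamma (s + d₁))⁻¹ *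
        (Complex.Gamma (s + d₂))⁻¹ * (Complex.Gamma (s + d₃))⁻¹)) := by
  have hp : 0 < (s + p).re := by simp only [Complex.add_re] at hq ⊢; linarith
  set F : ℕ × ℕ → ℂ := fun mn => kernelTerm d₁ d₂ d₃ p q mn.1 mn.2 *
    (Complex.Gamma (g + s + (mn.1 + mn.2 : ℕ)))⁻¹ with hF
  have hFN : ∀ N : ℕ, ∀ mn ∈ Finset.HasAntidiagonal.antidiagonal N,
      F mn = kernelTerm d₁ d₂ d₃ p q mn.1 mn.2 * (Complex.Gamma (g + s + N))⁻¹ := by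
    intro N mn h
    rw [Finset.HasAntidiagonal.mem_antidiagonal] at h
    rw [hF, ← h]
  have hsum : Summable F := by
    obtain ⟨θ, hθ, C, hC, hCN⟩ := exists_sum_norm_kernelTerm_le hg hpq hd hq
    obtain ⟨D, hD, hDN⟩ := exists_norm_inv_Gamma_add_nat_le (g + s)
    refine summable_of_sum_norm_antidiagonal_le
      ((summable_natCast_add_one_rpow (s := -1 - θ) (by linarith)).mul_left (C * D)) fun N => ?_
    have hN : (0 : ℝ) < N + 1 := by positivity
    have hNf : (0 : ℝ) < N.factorial := by exact_mod_cast N.factorial_pos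
    rw [Finset.sum_congr rfl fun mn h => by rw [hFN N mn h, norm_mul], ← Finset.sum_mul]
    refine (mul_le_mul (hCN N) (hDN N) (norm_nonneg _) (by positivity)).trans (le_of_eq ?_)
    rw [show (-1 - θ : ℝ) = ((g + s).re - 2 - θ) + (1 - (g + s).re) by ring, Real.rpow_add hN]
    field_simp
  have hvalue : ∑' mn, F mn = Complex.Gamma (s + p) * Complex.Gamma (s + q) *
      ((Complex.Gamma (s + d₁))⁻¹ * (Complex.Gamma (s + d₂))⁻¹ * (Complex.Gamma (s + d₃))⁻¹) := by
    rw [hsum.tsum_prod]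
    have hinner : ∀ m : ℕ, ∑' n, F (m, n) = Complex.Gamma (s + q) * (Complex.Gamma (s + d₁))⁻¹ *
        gaussTerm (d₃ - p) (d₂ - p) (s + d₂ + d₃ - p) m := by
      intro m
      have h1 : ∀ n, F (m, n) = poch (d₃ - p) m * poch (d₂ - p) m / m.factorial *
          gaussTerm (d₁ - q) (d₂ + d₃ - p - q + m) (g + s + m) n := by
        intro n
        simp only [hF, kernelTerm, gaussTerm]
        push_cast
        rw [add_assoc (g + s)]
        field_simp
      simp only [h1]
      have h2 : g + s + m - (d₁ - q) - (d₂ + d₃ - p - q + m) = s + q := by rw [hg]; ring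
      rw [tsum_mul_left, tsum_gaussTerm (by rwa [h2]), h2, gaussTerm,
        show g + s + m - (d₁ - q) = s + d₂ + d₃ - p + m by rw [hg]; ring,
        show g + s + m - (d₂ + d₃ - p - q + m) = s + d₁ by rw [hg]; ring]
      ring
    simp only [hinner]
    have h3 : s + d₂ + d₃ - p - (d₃ - p) - (d₂ - p) = s + p := by ring
    rw [tsum_mul_left, tsum_gaussTerm (by rwa [h3]), h3,
      show s + d₂ + d₃ - p - (d₃ - p) = s + d₂ by ring,
      show s + d₂ + d₃ - p - (d₂ - p) = s + d₃ by ring]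
    ring
  convert (hvalue ▸ hsum.hasSum).sum_antidiagonal using 2 with N
  rw [kernelCoeff, Finset.sum_mul, Finset.sum_congr rfl fun mn h => (hFN N mn h).symm]

/-- Growth of the coefficients and the value of the factorial series they generate, for all
admissible parameters: by the symmetries of the coefficients one may take `Re d₁` largest and
`Re q ≤ Re p`, and then `Re (s + d₁) > 0`. -/
theorem kernelCoeff_growth_and_hasSum {d₁ d₂ d₃ p q g s : ℂ} (hg : g = d₁ + d₂ + d₃ - p - q)
    (hg0 : 0 < g.re) (hs : 0 < s.re) (hp : 0 < (s + p).re) (hq : 0 < (s + q).re) :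
    (∃ θ : ℝ, 0 < θ ∧ ∃ C : ℝ, 0 < C ∧ ∀ N : ℕ, ‖kernelCoeff d₁ d₂ d₃ p q N‖ ≤
        C * (N.factorial * (N + 1 : ℝ) ^ ((g + s).re - 2 - θ))) ∧
    HasSum (fun N : ℕ => kernelCoeff d₁ d₂ d₃ p q N * (Complex.Gamma (g + s + N))⁻¹)
      (Complex.Gamma (s + p) * Complex.Gamma (s + q) * ((Complex.Gamma (s + d₁))⁻¹ *
        (Complex.Gamma (s + d₂))⁻¹ * (Complex.Gamma (s + d₃))⁻¹)) := by
  wlog hpq : q.re ≤ p.re generalizing p q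
  · have := this (p := q) (q := p) (by rw [hg]; ring) hq hp (le_of_not_ge hpq)
    rwa [kernelCoeff_swap_p_q, mul_comm (Complex.Gamma (s + q))] at this
  wlog h12 : d₂.re ≤ d₁.re generalizing d₁ d₂
  · have := this (d₁ := d₂) (d₂ := d₁) (by rw [hg]; ring) (le_of_not_ge h12)
    rwa [kernelCoeff_swap_d₁_d₂, mul_comm (Complex.Gamma (s + d₂))⁻¹] at this
  have main : ∀ {d₁ d₂ d₃ : ℂ}, g = d₁ + d₂ + d₃ - p - q → d₂.re ≤ d₁.re → d₃.re ≤ d₁.re →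
      (∃ θ : ℝ, 0 < θ ∧ ∃ C : ℝ, 0 < C ∧ ∀ N : ℕ, ‖kernelCoeff d₁ d₂ d₃ p q N‖ ≤
        C * (N.factorial * (N + 1 : ℝ) ^ ((g + s).re - 2 - θ))) ∧
      HasSum (fun N : ℕ => kernelCoeff d₁ d₂ d₃ p q N * (Complex.Gamma (g + s + N))⁻¹)
        (Complex.Gamma (s + p) * Complex.Gamma (s + q) * ((Complex.Gamma (s + d₁))⁻¹ *
          (Complex.Gamma (s + d₂))⁻¹ * (Complex.Gamma (s + d₃))⁻¹)) := by
    intro d₁ d₂ d₃ hg h2 h3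
    have hd : 0 < (s + d₁).re := by
      rw [hg] at hg0
      simp only [Complex.add_re, Complex.sub_re] at hg0 hp hq ⊢
      linarith
    obtain ⟨θ, hθ, C, hC, h⟩ := exists_sum_norm_kernelTerm_le hg hpq hd hq
    exact ⟨⟨θ, hθ, C, hC, fun N => (norm_kernelCoeff_le _ _ _ _ _ N).trans (h N)⟩,
      hasSum_kernelCoeff_mul_inv_Gamma_of_le hg hpq hd hq⟩
  rcases le_total d₃.re d₁.re with h13 | h13
  · exact main hg h12 h13
  · have := main (d₁ := d₃) (d₂ := d₁) (d₃ := d₂) (by rw [hg]; ring) h13 (h12.trans h13)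
    rw [kernelCoeff_swap_d₁_d₂, kernelCoeff_swap_d₂_d₃,
      mul_comm (Complex.Gamma (s + d₃))⁻¹, mul_right_comm (Complex.Gamma (s + d₁))⁻¹] at this
    exact this

/-! ### The Mellin transform of the kernel -/

theorem integrable_tsum_of_summable_integral_norm {α : Type*} [MeasurableSpace α] {μ : Measure α}
    {F : ℕ → α → ℂ} (hF : ∀ i, Integrable (F i) μ) (hs : Summable fun i => ∫ a, ‖F i a‖ ∂μ) :
    Integrable (fun a => ∑' i, F i a) μ := by
  have h1 : ∫⁻ a, ∑' i, ‖F i a‖ₑ ∂μ < ⊤ := by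
    rw [lintegral_tsum fun i => (hF i).1.enorm]
    simp only [← fun i => ofReal_integral_norm_eq_lintegral_enorm (hF i)]
    rw [← ENNReal.ofReal_tsum_of_nonneg (fun i => integral_nonneg fun _ => norm_nonneg _) hs]
    exact ENNReal.ofReal_lt_top
  have h2 : ∀ᵐ a ∂μ, Summable fun i => F i a := by
    filter_upwards [ae_lt_top' (AEMeasurable.tsum fun i => (hF i).1.enorm) h1.ne] with a ha
    have h3 : Summable fun i => ‖F i a‖₊ := ENNReal.tsum_coe_ne_top_iff_summable.1 ha.ne
    exact h3.of_nnnorm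
  refine ⟨aestronglyMeasurable_of_tendsto_ae atTop
    (f := fun (n : ℕ) a => ∑ i ∈ Finset.range n, F i a)
    (fun n => Finset.aestronglyMeasurable_fun_sum _ fun i _ => (hF i).1) ?_, ?_⟩
  · filter_upwards [h2] with a ha using ha.hasSum.tendsto_sum_nat
  · refine (lintegral_mono fun a => ?_).trans_lt h1
    exact enorm_tsum_le_tsum_enorm

/-- The integrand of the Beta integral. -/
noncomputable def betaKernel (s v : ℂ) (u : ℝ) : ℂ := (u : ℂ) ^ (s - 1) * (1 - u : ℂ) ^ (v - 1)

theorem integrable_betaKernel {s v : ℂ} (hs : 0 < s.re) (hv : 0 < v.re) :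
    Integrable (betaKernel s v) (volume.restrict (Ioo 0 1)) := by
  have h := Complex.betaIntegral_convergent hs hv
  rw [intervalIntegrable_iff_integrableOn_Ioo_of_le zero_le_one] at h
  exact h

theorem integral_betaKernel {s v : ℂ} (hs : 0 < s.re) (hv : 0 < v.re) :
    ∫ u in Ioo (0 : ℝ) 1, betaKernel s v u =
      Complex.Gamma s * Complex.Gamma v * (Complex.Gamma (s + v))⁻¹ := by
  rw [← div_eq_mul_inv, ← Complex.betaIntegral_eq_Gamma_mul_div s v hs hv, Complex.betaIntegral,
    intervalIntegral.integral_of_le zero_le_one, integral_Ioc_eq_integral_Ioo]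
  rfl

theorem norm_betaKernel (s v : ℂ) {u : ℝ} (hu : u ∈ Ioo (0 : ℝ) 1) :
    ((‖betaKernel s v u‖ : ℝ) : ℂ) = betaKernel s.re v.re u := by
  have h1 : 0 < 1 - u := sub_pos.2 hu.2
  rw [betaKernel, betaKernel, norm_mul, Complex.norm_cpow_eq_rpow_re_of_pos hu.1,
    show (1 - u : ℂ) = ((1 - u : ℝ) : ℂ) by push_cast; rfl,
    Complex.norm_cpow_eq_rpow_re_of_pos h1]
  push_cast
  rw [Complex.ofReal_cpow hu.1.le, Complex.ofReal_cpow h1.le]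
  simp

theorem integral_norm_betaKernel {s v : ℂ} (hs : 0 < s.re) (hv : 0 < v.re) :
    ((∫ u in Ioo (0 : ℝ) 1, ‖betaKernel s v u‖ : ℝ) : ℂ) =
      Complex.Gamma s.re * Complex.Gamma v.re * (Complex.Gamma (s.re + v.re))⁻¹ := by
  rw [← integral_betaKernel (by simpa using hs) (by simpa using hv), ← integral_complex_ofReal]
  exact setIntegral_congr_fun measurableSet_Ioo fun u hu => norm_betaKernel s v hu

theorem exists_integral_norm_betaKernel_le {s g : ℂ} (hs : 0 < s.re) (hg : 0 < g.re) :
    ∃ C : ℝ, 0 < C ∧ ∀ N : ℕ, ∫ u in Ioo (0 : ℝ) 1, ‖betaKernel s (g + N) u‖ ≤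
      C * (N + 1 : ℝ) ^ (-s.re) := by
  have hg' : 0 < (g.re : ℂ).re := by simpa using hg
  have hs' : 0 < (s.re : ℂ).re := by simpa using hs
  obtain ⟨A, hA, ha⟩ := exists_norm_poch_le (g.re : ℂ)
  obtain ⟨D, hD, hd⟩ := exists_norm_inv_Gamma_add_nat_le (s.re + g.re : ℂ)
  have h1 := norm_pos_iff.2 (Complex.Gamma_ne_zero_of_re_pos hg')
  have h2 := norm_pos_iff.2 (Complex.Gamma_ne_zero_of_re_pos hs')
  refine ⟨A * D * (‖Complex.Gamma g.re‖ * ‖Complex.Gamma s.re‖), by positivity, fun N => ?_⟩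
  have hN : (0 : ℝ) < N + 1 := by positivity
  have hNf : (0 : ℝ) < N.factorial := by exact_mod_cast N.factorial_pos
  have h3 := congrArg norm (integral_norm_betaKernel (s := s) (v := g + N) hs
    (by simp; positivity))
  rw [Complex.norm_real, Real.norm_of_nonneg (integral_nonneg fun _ => norm_nonneg _)] at h3
  rw [h3, Complex.add_re, Complex.natCast_re, Complex.ofReal_add, Complex.ofReal_natCast,
    Gamma_add_nat_of_re_pos hg', ← add_assoc, norm_mul, norm_mul, norm_mul]
  calc _ ≤ ‖Complex.Gamma s.re‖ * ((A * (N.factorial * (N + 1 : ℝ) ^ ((g.re : ℂ).re - 1))) *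
        ‖Complex.Gamma g.re‖) *
        (D * ((N + 1 : ℝ) ^ (1 - (s.re + g.re : ℂ).re) / N.factorial)) := by
        gcongr
        · exact ha N
        · exact hd N
    _ = A * D * (‖Complex.Gamma g.re‖ * ‖Complex.Gamma s.re‖) *
        ((N + 1 : ℝ) ^ ((g.re : ℂ).re - 1) * (N + 1 : ℝ) ^ (1 - (s.re + g.re : ℂ).re)) := by
        field_simp
    _ = _ := by
        rw [← Real.rpow_add hN]
        congr 2
        simp only [Complex.add_re, Complex.ofReal_re]; ring

/-- The power series `H` for which the kernel is `(1 - u) ^ (γ - 1) * H (1 - u)`, with `g` in the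
place of `γ`; it is used for `g = d₁ + d₂ + d₃ - p - q`. -/
noncomputable def kernelSeries (d₁ d₂ d₃ p q g w : ℂ) : ℂ :=
  ∑' N : ℕ, kernelCoeff d₁ d₂ d₃ p q N / poch g N * w ^ N

/-- The Mellin transform of the kernel, with absolute convergence. -/
theorem integrable_and_integral_kernelSeries {d₁ d₂ d₃ p q g s : ℂ}
    (hg : g = d₁ + d₂ + d₃ - p - q)
    (hg0 : 0 < g.re) (hs : 0 < s.re) (hp : 0 < (s + p).re) (hq : 0 < (s + q).re) :
    Integrable (fun u : ℝ => betaKernel s g u * kernelSeries d₁ d₂ d₃ p q g (1 - u))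
      (volume.restrict (Ioo 0 1)) ∧
    ∫ u in Ioo (0 : ℝ) 1, betaKernel s g u * kernelSeries d₁ d₂ d₃ p q g (1 - u) =
      Complex.Gamma g * (Complex.Gamma s * (Complex.Gamma (s + p) * Complex.Gamma (s + q) *
        ((Complex.Gamma (s + d₁))⁻¹ * (Complex.Gamma (s + d₂))⁻¹ *
          (Complex.Gamma (s + d₃))⁻¹))) := by
  obtain ⟨⟨θ, hθ, C, hC, hCN⟩, hsum⟩ := kernelCoeff_growth_and_hasSum hg hg0 hs hp hq
  obtain ⟨B, hB, hBN⟩ := exists_integral_norm_betaKernel_le hs hg0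
  obtain ⟨D, hD, hDN⟩ := exists_norm_inv_Gamma_add_nat_le g
  have hgN : ∀ N : ℕ, 0 < (g + N).re := fun N => by simp; positivity
  have hΓg := Complex.Gamma_ne_zero_of_re_pos hg0
  set F : ℕ → ℝ → ℂ := fun N u =>
    kernelCoeff d₁ d₂ d₃ p q N / poch g N * betaKernel s (g + N) u with hF
  have hint : ∀ N, Integrable (F N) (volume.restrict (Ioo 0 1)) := fun N =>
    (integrable_betaKernel hs (hgN N)).const_mul _
  have hnorm : Summable fun N => ∫ u in Ioo (0 : ℝ) 1, ‖F N u‖ := by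
    refine Summable.of_nonneg_of_le (fun N => integral_nonneg fun _ => norm_nonneg _) (fun N => ?_)
      ((summable_natCast_add_one_rpow (s := -1 - θ) (by linarith)).mul_left
        (C * (‖Complex.Gamma g‖ * D) * B))
    have hN : (0 : ℝ) < N + 1 := by positivity
    have hNf : (0 : ℝ) < N.factorial := by exact_mod_cast N.factorial_pos
    simp only [hF, norm_mul]
    rw [integral_const_mul, norm_div, div_eq_mul_inv]
    have h1 : ‖poch g N‖⁻¹ ≤ ‖Complex.Gamma g‖ *
        (D * ((N + 1 : ℝ) ^ (1 - g.re) / N.factorial)) := by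
      refine le_trans (le_of_eq ?_) (mul_le_mul_of_nonneg_left (hDN N) (norm_nonneg _))
      rw [Gamma_add_nat_of_re_pos hg0, norm_inv, norm_mul]
      have := norm_pos_iff.2 hΓg
      field_simp
    calc _ ≤ (C * (N.factorial * (N + 1 : ℝ) ^ ((g + s).re - 2 - θ))) * (‖Complex.Gamma g‖ *
          (D * ((N + 1 : ℝ) ^ (1 - g.re) / N.factorial))) * (B * (N + 1 : ℝ) ^ (-s.re)) := by
          gcongr
          · exact hCN N
          · exact hBN N
      _ = C * (‖Complex.Gamma g‖ * D) * B * ((N + 1 : ℝ) ^ ((g + s).re - 2 - θ) *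
          (N + 1 : ℝ) ^ (1 - g.re) * (N + 1 : ℝ) ^ (-s.re)) := by field_simp
      _ = _ := by
          rw [← Real.rpow_add hN, ← Real.rpow_add hN]
          congr 2
          simp only [Complex.add_re]; ring
  have htsum : ∀ u ∈ Ioo (0 : ℝ) 1, ∑' N, F N u =
      betaKernel s g u * kernelSeries d₁ d₂ d₃ p q g (1 - u) := by
    intro u hu
    rw [kernelSeries, ← tsum_mul_left]
    refine tsum_congr fun N => ?_
    have h1 : (1 - u : ℂ) ≠ 0 := by
      rw [sub_ne_zero]; exact_mod_cast hu.2.ne'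
    simp only [hF, betaKernel]
    rw [show g + N - 1 = g - 1 + N by ring, Complex.cpow_add _ _ h1, Complex.cpow_natCast]
    ring
  have h2 := integrable_tsum_of_summable_integral_norm hint hnorm
  have h3 := hasSum_integral_of_summable_integral_norm hint hnorm
  rw [setIntegral_congr_fun measurableSet_Ioo htsum] at h3
  refine ⟨h2.congr ((ae_restrict_iff' measurableSet_Ioo).2 (ae_of_all _ htsum)), ?_⟩
  have h4 : ∀ N, ∫ u in Ioo (0 : ℝ) 1, F N u = Complex.Gamma g * (Complex.Gamma s *
      (kernelCoeff d₁ d₂ d₃ p q N * (Complex.Gamma (g + s + N))⁻¹)) := by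
    intro N
    simp only [hF]
    have h5 := poch_ne_zero_of_re_pos hg0 N
    rw [integral_const_mul, integral_betaKernel hs (hgN N), Gamma_add_nat_of_re_pos hg0,
      show s + (g + N) = g + s + N by ring]
    field_simp
  simp only [h4] at h3
  exact h3.unique ((hsum.mul_left (Complex.Gamma s)).mul_left (Complex.Gamma g))

/-! ### Pfaff's transformation -/

theorem exists_norm_poch_le_pow (z : ℂ) : ∃ C : ℝ, 0 < C ∧ ∃ k : ℕ, ∀ n : ℕ,
    ‖poch z n‖ ≤ C * (n.factorial * (n + 1 : ℝ) ^ k) := by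
  obtain ⟨C, hC, h⟩ := exists_norm_poch_le z
  obtain ⟨k, hk⟩ := exists_nat_gt (z.re - 1)
  refine ⟨C, hC, k, fun n => (h n).trans ?_⟩
  rw [← Real.rpow_natCast]
  gcongr
  linarith [(n.cast_nonneg : (0 : ℝ) ≤ n)]

theorem exists_norm_poch_add_le_pow (z : ℂ) : ∃ C : ℝ, 0 < C ∧ ∃ k : ℕ, ∀ m n : ℕ,
    ‖poch (z + m) n‖ ≤ C * (((m + n).factorial : ℝ) / m.factorial * (n + 1 : ℝ) ^ k) := by
  obtain ⟨C, hC, h⟩ := exists_norm_poch_add_le z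
  obtain ⟨k, hk⟩ := exists_nat_gt (z.re - 1)
  refine ⟨C, hC, k, fun m n => (h m n).trans ?_⟩
  have hm : (0 : ℝ) ≤ m := m.cast_nonneg
  have hn : (0 : ℝ) ≤ n := n.cast_nonneg
  have h1 : 1 ≤ ((m + n : ℕ) + 1 : ℝ) / (m + 1) := by
    rw [one_le_div (by positivity)]; push_cast; linarith
  have h2 : ((m + n : ℕ) + 1 : ℝ) / (m + 1) ≤ n + 1 := by
    rw [div_le_iff₀ (by positivity)]; push_cast; nlinarith
  gcongr
  refine (Real.rpow_le_rpow_of_exponent_le h1 hk.le).trans ?_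
  rw [Real.rpow_natCast]
  gcongr

theorem exists_norm_inv_poch_le_mul {z : ℂ} (hz : 0 < z.re) : ∃ C : ℝ, 0 < C ∧ ∀ n : ℕ,
    ‖(poch z n)⁻¹‖ ≤ C * ((n + 1 : ℝ) / n.factorial) := by
  obtain ⟨D, hD, h⟩ := exists_norm_inv_Gamma_add_nat_le z
  have hΓ := norm_pos_iff.2 (Complex.Gamma_ne_zero_of_re_pos hz)
  refine ⟨‖Complex.Gamma z‖ * D, by positivity, fun n => ?_⟩
  have hn : (0 : ℝ) ≤ n := n.cast_nonneg
  have h1 : ‖(poch z n)⁻¹‖ = ‖Complex.Gamma z‖ * ‖(Complex.Gamma (z + n))⁻¹‖ := by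
    rw [Gamma_add_nat_of_re_pos hz, norm_inv, norm_inv, norm_mul]; field_simp
  have h2 : (n + 1 : ℝ) ^ (1 - z.re) ≤ n + 1 := by
    calc (n + 1 : ℝ) ^ (1 - z.re) ≤ (n + 1 : ℝ) ^ (1 : ℝ) :=
          Real.rpow_le_rpow_of_exponent_le (by linarith) (by linarith)
      _ = n + 1 := Real.rpow_one _
  rw [h1, mul_assoc]
  gcongr
  refine (h n).trans ?_
  gcongr

theorem summable_natCast_add_one_pow_mul_geometric (k : ℕ) {r : ℝ} (hr0 : 0 < r) (hr : r < 1) :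
    Summable fun n : ℕ => (n + 1 : ℝ) ^ k * r ^ n := by
  have h0 : Summable fun n : ℕ => (n : ℝ) ^ k * r ^ n :=
    summable_pow_mul_geometric_of_norm_lt_one k (by rwa [Real.norm_of_nonneg hr0.le])
  have h : Summable fun n : ℕ => ((n + 1 : ℕ) : ℝ) ^ k * r ^ (n + 1) :=
    (summable_nat_add_iff 1).2 h0
  refine (h.mul_right r⁻¹).congr fun n => ?_
  push_cast
  rw [pow_succ]
  field_simp

/-- The binomial series `(1 - y) ^ (-a) = ∑ (a)_n y ^ n / n!`. -/
theorem hasSum_poch_div_factorial_mul_pow (a : ℂ) {y : ℂ} (hy : ‖y‖ < 1) :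
    HasSum (fun n : ℕ => poch a n / n.factorial * y ^ n) ((1 - y) ^ (-a)) := by
  have h := (Complex.one_div_one_sub_cpow_hasFPowerSeriesOnBall_zero a).hasSum (y := y)
    (by rw [← ENNReal.ofReal_one, Metric.eball_ofReal]; simpa using hy)
  have hcoeff : ∀ n : ℕ, Ring.choose (a + n - 1) n = poch a n / n.factorial := by
    intro n
    have hf : (n.factorial : ℂ) ≠ 0 := by exact_mod_cast n.factorial_ne_zero
    rw [← Ring.multichoose_eq, poch, ← Polynomial.ascPochhammer_smeval_eq_eval,
      ← Ring.factorial_nsmul_multichoose_eq_ascPochhammer, nsmul_eq_mul]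
    field_simp
  simpa [FormalMultilinearSeries.ofScalars_apply_eq, hcoeff, Complex.cpow_neg, mul_comm] using h

/-- **Pfaff's transformation** of the Gauss hypergeometric series near the origin. -/
theorem tsum_pfaff (a f : ℂ) {c : ℂ} (hc : 0 < c.re) {y : ℂ} (hy : ‖y‖ < 1 / 3) :
    ∑' n : ℕ, poch a n * poch (c - f) n / (poch c n * n.factorial) * y ^ n =
      (1 - y) ^ (-a) *
        ∑' n : ℕ, poch a n * poch f n / (poch c n * n.factorial) * (y / (y - 1)) ^ n := by
  have hfac : ∀ n : ℕ, (n.factorial : ℂ) ≠ 0 := fun n => by exact_mod_cast n.factorial_ne_zero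
  have hpc := poch_ne_zero_of_re_pos hc
  set F : ℕ × ℕ → ℂ := fun nk => (-1) ^ nk.1 * poch a (nk.1 + nk.2) * poch f nk.1 /
    (poch c nk.1 * nk.1.factorial * nk.2.factorial) * y ^ (nk.1 + nk.2) with hF
  have hsum : Summable F := by
    obtain ⟨A, hA, i, ha⟩ := exists_norm_poch_le_pow a
    obtain ⟨B, hB, j, hb⟩ := exists_norm_poch_le_pow f
    obtain ⟨D, hD, hd⟩ := exists_norm_inv_poch_le_mul hc
    refine summable_of_sum_norm_antidiagonal_le (B := fun N => A * B * D * (((N + 1 : ℝ) ^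
      (i + j + 1)) * (2 / 3) ^ N)) ((summable_natCast_add_one_pow_mul_geometric (i + j + 1)
        (by norm_num) (by norm_num)).mul_left _) fun N => ?_
    have hterm : ∀ nk ∈ Finset.HasAntidiagonal.antidiagonal N, ‖F nk‖ ≤
        A * B * D * ((N + 1 : ℝ) ^ (i + j + 1) * (1 / 3) ^ N) * (N.choose nk.1 : ℝ) := by
      rintro ⟨n, k⟩ hnk
      have hch := choose_eq_of_mem_antidiagonal hnk
      rw [Finset.HasAntidiagonal.mem_antidiagonal] at hnk
      dsimp only at hnk hch
      have hch' : (N.choose n : ℝ) = N.factorial / (n.factorial * k.factorial) := by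
        have h0 := congrArg Complex.re hch
        rw [← Complex.ofReal_natCast, ← Complex.ofReal_natCast, ← Complex.ofReal_natCast,
          ← Complex.ofReal_natCast, ← Complex.ofReal_mul, ← Complex.ofReal_div] at h0
        simpa only [Complex.ofReal_re] using h0
      have hnN : (n + 1 : ℝ) ≤ N + 1 := by
        have : n ≤ N := by omega
        have : (n : ℝ) ≤ N := by exact_mod_cast this
        linarith
      have hn0 : (0 : ℝ) < n.factorial := by exact_mod_cast n.factorial_pos
      have hk0 : (0 : ℝ) < k.factorial := by exact_mod_cast k.factorial_pos
      simp only [hF, hnk]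
      rw [mul_assoc (poch c n), ← div_div, div_eq_mul_inv _ (poch c n)]
      simp only [norm_mul, norm_div, norm_pow, norm_neg, norm_one, one_pow, one_mul,
        Complex.norm_natCast]
      calc ‖poch a N‖ * ‖poch f n‖ * ‖(poch c n)⁻¹‖ / (n.factorial * k.factorial) * ‖y‖ ^ N
          ≤ (A * (N.factorial * (N + 1 : ℝ) ^ i)) * (B * (n.factorial * (n + 1 : ℝ) ^ j)) *
            (D * ((n + 1 : ℝ) / n.factorial)) / (n.factorial * k.factorial) * (1 / 3) ^ N := by
            gcongr
            · exact ha N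
            · exact hb n
            · exact hd n
        _ ≤ (A * (N.factorial * (N + 1 : ℝ) ^ i)) * (B * (n.factorial * (N + 1 : ℝ) ^ j)) *
            (D * ((N + 1 : ℝ) / n.factorial)) / (n.factorial * k.factorial) * (1 / 3) ^ N := by
            gcongr
        _ = _ := by rw [hch', pow_succ, pow_add]; field_simp
    refine (Finset.sum_le_sum hterm).trans (le_of_eq ?_)
    have h2 : ∑ nk ∈ Finset.HasAntidiagonal.antidiagonal N, (N.choose nk.1 : ℝ) = 2 ^ N := by
      rw [Finset.Nat.sum_antidiagonal_eq_sum_range_succ (fun i _ => (N.choose i : ℝ)) N]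
      exact_mod_cast Nat.sum_range_choose N
    rw [← Finset.mul_sum, h2, div_pow, div_pow]
    ring
  have hleft : ∀ N : ℕ, ∑ nk ∈ Finset.HasAntidiagonal.antidiagonal N, F nk =
      poch a N * poch (c - f) N / (poch c N * N.factorial) * y ^ N := by
    intro N
    have h := sum_antidiagonal_neg_one_pow_mul_poch c f N
    rw [show poch a N * poch (c - f) N / (poch c N * N.factorial) * y ^ N =
      poch a N / poch c N * y ^ N * (poch (c - f) N / N.factorial) by
        have := hfac N; have := hpc N; field_simp, ← h, Finset.mul_sum]
    refine Finset.sum_congr rfl fun nk hnk => ?_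
    rw [Finset.HasAntidiagonal.mem_antidiagonal] at hnk
    have h1 : poch c N = poch c nk.1 * poch (c + nk.1) nk.2 := by rw [← hnk, poch_add]
    have h2 := hpc N
    have h3 := hpc nk.1
    have h4 := hfac nk.1
    have h5 := hfac nk.2
    have h6 : poch (c + nk.1) nk.2 ≠ 0 := fun h0 => h2 (by rw [h1, h0, mul_zero])
    simp only [hF, hnk]
    rw [h1]
    field_simp
  have hy1 : 1 - y ≠ 0 := by
    rw [sub_ne_zero]; rintro rfl; norm_num at hy
  have hright : ∀ n : ℕ, ∑' k, F (n, k) = (1 - y) ^ (-a) *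
      (poch a n * poch f n / (poch c n * n.factorial) * (y / (y - 1)) ^ n) := by
    intro n
    have h1 : ∀ k, F (n, k) = (-1) ^ n * poch a n * poch f n / (poch c n * n.factorial) * y ^ n *
        (poch (a + n) k / k.factorial * y ^ k) := by
      intro k
      simp only [hF, poch_add, pow_add]
      have := hfac n; have := hfac k; have := hpc n
      field_simp
    simp only [h1]
    rw [tsum_mul_left, (hasSum_poch_div_factorial_mul_pow (a + n) (by linarith)).tsum_eq,
      neg_add, Complex.cpow_add _ _ hy1, Complex.cpow_neg _ (n : ℂ), Complex.cpow_natCast,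
      show y / (y - 1) = -1 * y / (1 - y) by
        rw [← neg_sub 1 y, div_neg]; ring, div_pow, mul_pow]
    field_simp
  have h1 := hsum.hasSum.sum_antidiagonal.tsum_eq
  simp only [hleft] at h1
  rw [h1, hsum.tsum_prod, ← tsum_mul_left]
  exact tsum_congr hright

/-! ### The continuation of Appell's third function -/

/-- The double power series whose restriction to the diagonal is `kernelSeries`. It continues
`F₃ (x, y)`, up to the factor `(1 - y) ^ (q - d₁)`, in the variables `x` and `z = y / (y - 1)`. -/
noncomputable def kernelDoubleSeries (d₁ d₂ d₃ p q g x z : ℂ) : ℂ :=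
  ∑' mn : ℕ × ℕ,
    kernelTerm d₁ d₂ d₃ p q mn.1 mn.2 / poch g (mn.1 + mn.2) * x ^ mn.1 * z ^ mn.2

theorem factorial_mul_factorial_le_factorial_add (m n : ℕ) :
    (m.factorial : ℝ) * n.factorial ≤ (m + n).factorial := by
  exact_mod_cast Nat.le_of_dvd (Nat.factorial_pos _)
    (Nat.factorial_mul_factorial_dvd_factorial_add m n)

theorem summable_pow_mul_pow_mul_geometric (k : ℕ) {r : ℝ} (hr0 : 0 < r) (hr : r < 1) :
    Summable fun mn : ℕ × ℕ => ((mn.1 + 1 : ℝ) * (mn.2 + 1)) ^ k * r ^ mn.1 * r ^ mn.2 := by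
  have h := summable_natCast_add_one_pow_mul_geometric k hr0 hr
  refine (h.mul_of_nonneg h (fun n => by positivity) fun n => by positivity).congr fun mn => ?_
  rw [mul_pow]; ring

theorem exists_norm_kernelTerm_div_poch_le (d₁ d₂ d₃ p q : ℂ) {g : ℂ} (hg : 0 < g.re) :
    ∃ C : ℝ, ∃ k : ℕ, ∀ m n : ℕ, ‖kernelTerm d₁ d₂ d₃ p q m n / poch g (m + n)‖ ≤
      C * ((m + 1 : ℝ) * (n + 1)) ^ k := by
  obtain ⟨A₁, hA₁, k₁, h₁⟩ := exists_norm_poch_le_pow (d₃ - p)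
  obtain ⟨A₂, hA₂, k₂, h₂⟩ := exists_norm_poch_le_pow (d₂ - p)
  obtain ⟨A₃, hA₃, k₃, h₃⟩ := exists_norm_poch_le_pow (d₁ - q)
  obtain ⟨A₄, hA₄, k₄, h₄⟩ := exists_norm_poch_add_le_pow (d₂ + d₃ - p - q)
  obtain ⟨D, hD, hd⟩ := exists_norm_inv_poch_le_mul hg
  refine ⟨A₁ * A₂ * A₃ * A₄ * D, k₁ + k₂ + k₃ + k₄ + 1, fun m n => ?_⟩
  have hm : (1 : ℝ) ≤ m + 1 := by linarith [(m.cast_nonneg : (0 : ℝ) ≤ m)]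
  have hn : (1 : ℝ) ≤ n + 1 := by linarith [(n.cast_nonneg : (0 : ℝ) ≤ n)]
  have hmn : ((m + n : ℕ) + 1 : ℝ) ≤ (m + 1) * (n + 1) := by push_cast; nlinarith
  have hmf : (0 : ℝ) < m.factorial := by exact_mod_cast m.factorial_pos
  have hnf : (0 : ℝ) < n.factorial := by exact_mod_cast n.factorial_pos
  have hmnf : (0 : ℝ) < (m + n).factorial := by exact_mod_cast (m + n).factorial_pos
  set t : ℝ := (m + 1 : ℝ) * (n + 1) with ht
  have htm : (m + 1 : ℝ) ≤ t := by rw [ht]; nlinarith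
  have htn : (n + 1 : ℝ) ≤ t := by rw [ht]; nlinarith
  rw [div_eq_mul_inv, norm_mul, kernelTerm, norm_div, norm_mul, norm_mul, norm_mul, norm_mul,
    Complex.norm_natCast, Complex.norm_natCast]
  calc _ ≤ (A₁ * (m.factorial * (m + 1 : ℝ) ^ k₁)) * (A₂ * (m.factorial * (m + 1 : ℝ) ^ k₂)) *
        (A₃ * (n.factorial * (n + 1 : ℝ) ^ k₃)) *
        (A₄ * (((m + n).factorial : ℝ) / m.factorial * (n + 1 : ℝ) ^ k₄)) /
        (m.factorial * n.factorial) * (D * (((m + n : ℕ) + 1 : ℝ) / (m + n).factorial)) := by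
        gcongr
        · exact h₁ m
        · exact h₂ m
        · exact h₃ n
        · exact h₄ m n
        · exact hd (m + n)
    _ ≤ (A₁ * (m.factorial * t ^ k₁)) * (A₂ * (m.factorial * t ^ k₂)) *
        (A₃ * (n.factorial * t ^ k₃)) *
        (A₄ * (((m + n).factorial : ℝ) / m.factorial * t ^ k₄)) /
        (m.factorial * n.factorial) * (D * (t / (m + n).factorial)) := by
        gcongr
    _ = _ := by rw [pow_succ, pow_add, pow_add, pow_add]; field_simp

theorem summable_kernelDoubleSeries (d₁ d₂ d₃ p q : ℂ) {g x z : ℂ} (hg : 0 < g.re)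
    (hx : ‖x‖ < 1) (hz : ‖z‖ < 1) : Summable fun mn : ℕ × ℕ =>
      kernelTerm d₁ d₂ d₃ p q mn.1 mn.2 / poch g (mn.1 + mn.2) * x ^ mn.1 * z ^ mn.2 := by
  obtain ⟨C, k, h⟩ := exists_norm_kernelTerm_div_poch_le d₁ d₂ d₃ p q hg
  obtain ⟨r, hr1, hr⟩ := exists_between (max_lt hx hz)
  have hr0 : 0 < r := (norm_nonneg x).trans_lt ((le_max_left _ _).trans_lt hr1)
  refine Summable.of_norm_bounded ((summable_pow_mul_pow_mul_geometric k hr0 hr).mul_left C)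
    fun mn => ?_
  rw [norm_mul, norm_mul, norm_pow, norm_pow, mul_assoc, mul_assoc, ← mul_assoc C]
  exact mul_le_mul (h _ _) (mul_le_mul (pow_le_pow_left₀ (norm_nonneg _)
    ((le_max_left _ _).trans hr1.le) _) (pow_le_pow_left₀ (norm_nonneg _)
    ((le_max_right _ _).trans hr1.le) _) (by positivity) (by positivity)) (by positivity)
    ((norm_nonneg _).trans (h _ _))

theorem kernelDoubleSeries_self (d₁ d₂ d₃ p q : ℂ) {g w : ℂ} (hg : 0 < g.re) (hw : ‖w‖ < 1) :
    kernelDoubleSeries d₁ d₂ d₃ p q g w w = kernelSeries d₁ d₂ d₃ p q g w := by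
  have h := (summable_kernelDoubleSeries d₁ d₂ d₃ p q hg hw hw).hasSum.sum_antidiagonal.tsum_eq
  rw [kernelDoubleSeries, ← h, kernelSeries]
  refine tsum_congr fun N => ?_
  rw [kernelCoeff, Finset.sum_div, Finset.sum_mul]
  refine Finset.sum_congr rfl fun mn hmn => ?_
  rw [Finset.HasAntidiagonal.mem_antidiagonal] at hmn
  rw [hmn, mul_assoc, ← pow_add, hmn]

theorem summable_appellF3Series (a a' b b' : ℂ) {c x y : ℂ} (hc : 0 < c.re)
    (hx : ‖x‖ < 1) (hy : ‖y‖ < 1) : Summable fun mn : ℕ × ℕ =>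
      poch a mn.1 * poch a' mn.2 * poch b mn.1 * poch b' mn.2 /
        (poch c (mn.1 + mn.2) * (mn.1.factorial : ℂ) * (mn.2.factorial : ℂ)) *
        x ^ mn.1 * y ^ mn.2 := by
  obtain ⟨A₁, hA₁, k₁, h₁⟩ := exists_norm_poch_le_pow a
  obtain ⟨A₂, hA₂, k₂, h₂⟩ := exists_norm_poch_le_pow b
  obtain ⟨A₃, hA₃, k₃, h₃⟩ := exists_norm_poch_le_pow a'
  obtain ⟨A₄, hA₄, k₄, h₄⟩ := exists_norm_poch_le_pow b'
  obtain ⟨D, hD, hd⟩ := exists_norm_inv_poch_le_mul hc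
  obtain ⟨r, hr1, hr⟩ := exists_between (max_lt hx hy)
  have hr0 : 0 < r := (norm_nonneg x).trans_lt ((le_max_left _ _).trans_lt hr1)
  refine Summable.of_norm_bounded ((summable_pow_mul_pow_mul_geometric (k₁ + k₂ + k₃ + k₄ + 1)
    hr0 hr).mul_left (A₁ * A₂ * A₃ * A₄ * D)) ?_
  rintro ⟨m, n⟩
  dsimp only
  have hm : (1 : ℝ) ≤ m + 1 := by linarith [(m.cast_nonneg : (0 : ℝ) ≤ m)]
  have hn : (1 : ℝ) ≤ n + 1 := by linarith [(n.cast_nonneg : (0 : ℝ) ≤ n)]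
  have hmn : ((m + n : ℕ) + 1 : ℝ) ≤ (m + 1) * (n + 1) := by push_cast; nlinarith
  have hmf : (0 : ℝ) < m.factorial := by exact_mod_cast m.factorial_pos
  have hnf : (0 : ℝ) < n.factorial := by exact_mod_cast n.factorial_pos
  have hmnf : (0 : ℝ) < (m + n).factorial := by exact_mod_cast (m + n).factorial_pos
  set t : ℝ := (m + 1 : ℝ) * (n + 1) with ht
  have htm : (m + 1 : ℝ) ≤ t := by rw [ht]; nlinarith
  have htn : (n + 1 : ℝ) ≤ t := by rw [ht]; nlinarith
  have hxr : ‖x‖ ≤ r := (le_max_left _ _).trans hr1.le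
  have hyr : ‖y‖ ≤ r := (le_max_right _ _).trans hr1.le
  rw [mul_assoc (poch c (m + n)), ← div_div, div_eq_mul_inv _ (poch c (m + n))]
  simp only [norm_mul, norm_div, norm_pow, Complex.norm_natCast]
  calc _ ≤ (A₁ * (m.factorial * (m + 1 : ℝ) ^ k₁)) * (A₃ * (n.factorial * (n + 1 : ℝ) ^ k₃)) *
        (A₂ * (m.factorial * (m + 1 : ℝ) ^ k₂)) * (A₄ * (n.factorial * (n + 1 : ℝ) ^ k₄)) *
        (D * (((m + n : ℕ) + 1 : ℝ) / (m + n).factorial)) / (m.factorial * n.factorial) *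
        r ^ m * r ^ n := by
        gcongr
        · exact h₁ m
        · exact h₃ n
        · exact h₂ m
        · exact h₄ n
        · exact hd (m + n)
    _ ≤ (A₁ * (m.factorial * t ^ k₁)) * (A₃ * (n.factorial * t ^ k₃)) *
        (A₂ * (m.factorial * t ^ k₂)) * (A₄ * (n.factorial * t ^ k₄)) *
        (D * (t / (m.factorial * n.factorial))) / (m.factorial * n.factorial) *
        r ^ m * r ^ n := by
        gcongr
        exact factorial_mul_factorial_le_factorial_add m n
    _ = _ := by rw [pow_succ, pow_add, pow_add, pow_add]; field_simp

/-- Pfaff's transformation in the second variable of `F₃`, applied to each power of the first. -/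
theorem appellF3Series_eq_kernelDoubleSeries {d₁ d₂ d₃ p q g x y : ℂ}
    (hg : g = d₁ + d₂ + d₃ - p - q) (hg0 : 0 < g.re) (hx : ‖x‖ < 1) (hy : ‖y‖ < 1 / 3) :
    appellF3Series (d₃ - p) (d₁ - q) (d₂ - p) d₁ g x y =
      (1 - y) ^ (-(d₁ - q)) * kernelDoubleSeries d₁ d₂ d₃ p q g x (y / (y - 1)) := by
  have hz : ‖y / (y - 1)‖ < 1 := by
    have h1 : 2 / 3 < ‖y - 1‖ := by
      have := norm_sub_norm_le 1 y
      rw [norm_one, norm_sub_rev] at this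
      linarith
    rw [norm_div, div_lt_one (by linarith)]
    linarith
  rw [appellF3Series, (summable_appellF3Series _ _ _ _ hg0 hx (by linarith)).tsum_prod,
    kernelDoubleSeries, (summable_kernelDoubleSeries d₁ d₂ d₃ p q hg0 hx hz).tsum_prod,
    ← tsum_mul_left]
  refine tsum_congr fun m => ?_
  have hgm : 0 < (g + m).re := by simp; positivity
  have h := tsum_pfaff (d₁ - q) (d₂ + d₃ - p - q + m) hgm hy
  rw [show g + m - (d₂ + d₃ - p - q + m) = d₁ by rw [hg]; ring] at h
  have hfac : ∀ n : ℕ, (n.factorial : ℂ) ≠ 0 := fun n => by exact_mod_cast n.factorial_ne_zero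
  have hp1 := poch_ne_zero_of_re_pos hg0 m
  have hp2 := poch_ne_zero_of_re_pos hgm
  set K : ℂ := poch (d₃ - p) m * poch (d₂ - p) m / (poch g m * m.factorial) * x ^ m with hK
  have hl : ∀ n : ℕ, poch (d₃ - p) m * poch (d₁ - q) n * poch (d₂ - p) m * poch d₁ n /
      (poch g (m + n) * (m.factorial : ℂ) * (n.factorial : ℂ)) * x ^ m * y ^ n =
      K * (poch (d₁ - q) n * poch d₁ n / (poch (g + m) n * n.factorial) * y ^ n) := by
    intro n
    have := hfac m; have := hfac n; have := hp2 n
    rw [hK, poch_add]; field_simp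
  have hr : ∀ n : ℕ, kernelTerm d₁ d₂ d₃ p q m n / poch g (m + n) * x ^ m * (y / (y - 1)) ^ n =
      K * (poch (d₁ - q) n * poch (d₂ + d₃ - p - q + m) n / (poch (g + m) n * n.factorial) *
        (y / (y - 1)) ^ n) := by
    intro n
    have := hfac m; have := hfac n; have := hp2 n
    rw [hK, poch_add, kernelTerm]; field_simp
  simp only [hl, hr]
  rw [tsum_mul_left, tsum_mul_left, h]
  ring

/-- The kernel of the Marichev–Saigo–Maeda operator: at `(1 - u, 1 - 1 / u)` the variable
`y / (y - 1)` produced by Pfaff's transformation is again `1 - u`, so that `F₃` becomes a power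
series in one variable. -/
theorem appellF3_eq_cpow_mul_kernelSeries {d₁ d₂ d₃ p q g : ℂ}
    (hg : g = d₁ + d₂ + d₃ - p - q) (hg0 : 0 < g.re) {u : ℝ} (hu : u ∈ Ioo (0 : ℝ) 1) :
    appellF3 (d₃ - p) (d₁ - q) (d₂ - p) d₁ g ((1 - u : ℝ) : ℂ) ((1 - u⁻¹ : ℝ) : ℂ) =
      (u : ℂ) ^ (d₁ - q) * kernelSeries d₁ d₂ d₃ p q g (1 - u) := by
  obtain ⟨hu0, hu1⟩ := hu
  set X : ℂ := ((1 - u : ℝ) : ℂ) with hX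
  set Y : ℂ := ((1 - u⁻¹ : ℝ) : ℂ) with hY
  have hv : 0 < u⁻¹ - 1 := by have := (one_lt_inv₀ hu0).2 hu1; linarith
  have huv : u * u⁻¹ = 1 := mul_inv_cancel₀ hu0.ne'
  -- a common radius for both variables along the segment
  set r : ℝ := 1 - u / 2 with hr
  have hr0 : 0 < r := by linarith
  have hr1 : r < 1 := by linarith
  set U : Set ℂ := {s | ‖s * X‖ < r} ∩ {s | ‖s * Y‖ < r * ‖s * Y - 1‖} ∩
    {s | 1 - s * Y ∈ Complex.slitPlane} with hU
  have hUo : IsOpen U := by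
    refine ((isOpen_lt (by fun_prop) (by fun_prop)).inter
      (isOpen_lt (by fun_prop) (by fun_prop))).inter ?_
    exact Complex.isOpen_slitPlane.preimage (by fun_prop)
  have hUne : ∀ s ∈ U, s * Y - 1 ≠ 0 := by
    rintro s ⟨-, hs⟩ h0
    have : 1 - s * Y = 0 := by rw [← neg_sub, h0, neg_zero]
    rw [mem_ofPred_eq, this] at hs
    exact Complex.slitPlane_ne_zero hs rfl
  have hseg : segment ℝ (0 : ℂ) 1 ⊆ U := by
    intro s hs
    rw [segment_eq_image] at hs
    obtain ⟨t, ⟨ht0, ht1⟩, rfl⟩ := hs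
    have h1 : ((1 - t) • (0 : ℂ) + t • (1 : ℂ)) = (t : ℂ) := by simp
    beta_reduce
    rw [h1]
    have h2 : (t : ℂ) * Y - 1 = ((-(1 + t * (u⁻¹ - 1)) : ℝ) : ℂ) := by rw [hY]; push_cast; ring
    have htv : 0 ≤ t * (u⁻¹ - 1) := by positivity
    refine ⟨⟨?_, ?_⟩, ?_⟩
    · rw [mem_ofPred_eq, hX, ← Complex.ofReal_mul, Complex.norm_real, Real.norm_eq_abs,
        abs_of_nonneg (mul_nonneg ht0 (by linarith)), hr]
      nlinarith
    · rw [mem_ofPred_eq, h2, hY, ← Complex.ofReal_mul, Complex.norm_real, Complex.norm_real,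
        Real.norm_eq_abs, Real.norm_eq_abs, abs_neg, abs_of_nonpos (by linarith),
        abs_of_nonneg (by linarith), hr]
      have h3 : t * (u⁻¹ - 1) * (u / 2) = t * (1 - u) / 2 := by
        linear_combination t / 2 * huv
      nlinarith
    · rw [mem_ofPred_eq, ← neg_sub, h2, ← Complex.ofReal_neg, neg_neg]
      exact Complex.ofReal_mem_slitPlane.2 (by linarith)
  set G : ℂ → ℂ := fun s => (1 - s * Y) ^ (-(d₁ - q)) *
    kernelDoubleSeries d₁ d₂ d₃ p q g (s * X) (s * Y / (s * Y - 1)) with hG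
  have hcont : IsAppellF3Continuation (d₃ - p) (d₁ - q) (d₂ - p) d₁ g X Y G := by
    constructor
    · refine AnalyticOnNhd.mono (DifferentiableOn.analyticOnNhd ?_ hUo) hseg
      refine DifferentiableOn.mul ?_ ?_
      · refine DifferentiableOn.cpow (by fun_prop) (by fun_prop) fun s hs => hs.2
      · obtain ⟨C, k, h⟩ := exists_norm_kernelTerm_div_poch_le d₁ d₂ d₃ p q hg0
        unfold kernelDoubleSeries
        refine Complex.differentiableOn_tsum_of_summable_norm
          ((summable_pow_mul_pow_mul_geometric k hr0 hr1).mul_left C) (fun mn => ?_) hUo ?_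
        · refine DifferentiableOn.mul (by fun_prop) (DifferentiableOn.pow ?_ _)
          exact DifferentiableOn.div (by fun_prop) (by fun_prop) hUne
        · intro mn s hs
          have hsx : ‖s * X‖ ≤ r := hs.1.1.le
          have hsy : ‖s * Y / (s * Y - 1)‖ ≤ r := by
            rw [norm_div, div_le_iff₀ (norm_pos_iff.2 (hUne s hs))]
            exact hs.1.2.le
          rw [norm_mul, norm_mul, norm_pow, norm_pow, mul_assoc, mul_assoc, ← mul_assoc C]
          exact mul_le_mul (h _ _) (mul_le_mul (pow_le_pow_left₀ (norm_nonneg _) hsx _)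
            (pow_le_pow_left₀ (norm_nonneg _) hsy _) (by positivity) (by positivity))
            (by positivity) ((norm_nonneg _).trans (h _ _))
    · have h1 : ∀ᶠ s in 𝓝 (0 : ℂ), ‖s * X‖ < 1 :=
        (isOpen_lt (by fun_prop) (by fun_prop)).mem_nhds (by simp)
      have h2 : ∀ᶠ s in 𝓝 (0 : ℂ), ‖s * Y‖ < 1 / 3 :=
        (isOpen_lt (by fun_prop) (by fun_prop)).mem_nhds (by simp)
      filter_upwards [h1, h2] with s hs1 hs2
      rw [hG, appellF3Series_eq_kernelDoubleSeries hg hg0 hs1 hs2]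
  have huc : (u : ℂ) ≠ 0 := by exact_mod_cast hu0.ne'
  have h1 : Y / (Y - 1) = X := by rw [hX, hY]; push_cast; field_simp; ring
  have h2 : (1 - Y) ^ (-(d₁ - q)) = (u : ℂ) ^ (d₁ - q) := by
    rw [show 1 - Y = (u : ℂ)⁻¹ by rw [hY]; push_cast; ring, Complex.inv_cpow, Complex.cpow_neg,
      inv_inv]
    rw [Complex.arg_ofReal_of_nonneg hu0.le]
    exact Real.pi_pos.ne
  have hXn : ‖X‖ < 1 := by
    rw [hX, Complex.norm_real, Real.norm_of_nonneg (by linarith)]; linarith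
  rw [hcont.appellF3_eq, hG]
  simp only [one_mul]
  rw [h1, h2, kernelDoubleSeries_self _ _ _ _ _ hg0 hXn, hX]
  push_cast
  rfl

/-! ### The images of sine and hyperbolic sine -/

/-- Integration of the kernel against the sine series term by term; the integral of the absolute
value at `s` bounds those at `s + 2 k`. -/
theorem integrable_and_hasSum_integral_kernelSeries_mul_sin {d₁ d₂ d₃ p q g s : ℂ} (w : ℂ)
    (hg : g = d₁ + d₂ + d₃ - p - q)
    (hg0 : 0 < g.re) (hs : 0 < s.re) (hp : 0 < (s + p).re) (hq : 0 < (s + q).re) :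
    Integrable (fun u : ℝ => betaKernel (s - 1) g u * kernelSeries d₁ d₂ d₃ p q g (1 - u) *
      Complex.sin (w * u)) (volume.restrict (Ioo 0 1)) ∧
    HasSum (fun k : ℕ => (-1) ^ k * w ^ (2 * k + 1) / ((2 * k + 1).factorial : ℂ) *
      (Complex.Gamma g * (Complex.Gamma (s + (2 * k : ℕ)) *
        (Complex.Gamma (s + p + (2 * k : ℕ)) * Complex.Gamma (s + q + (2 * k : ℕ)) *
        ((Complex.Gamma (s + d₁ + (2 * k : ℕ)))⁻¹ * (Complex.Gamma (s + d₂ + (2 * k : ℕ)))⁻¹ *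
          (Complex.Gamma (s + d₃ + (2 * k : ℕ)))⁻¹)))))
      (∫ u in Ioo (0 : ℝ) 1, betaKernel (s - 1) g u * kernelSeries d₁ d₂ d₃ p q g (1 - u) *
        Complex.sin (w * u)) := by
  set K : ℂ → ℝ → ℂ := fun s u => betaKernel s g u * kernelSeries d₁ d₂ d₃ p q g (1 - u) with hK
  have hre : ∀ (z : ℂ) (k : ℕ), 0 < z.re → 0 < (z + k).re := fun z k hz => by simp; positivity
  have hshift : ∀ k : ℕ, Integrable (K (s + k)) (volume.restrict (Ioo 0 1)) ∧
      ∫ u in Ioo (0 : ℝ) 1, K (s + k) u = Complex.Gamma g * (Complex.Gamma (s + k) *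
        (Complex.Gamma (s + p + k) * Complex.Gamma (s + q + k) *
        ((Complex.Gamma (s + d₁ + k))⁻¹ * (Complex.Gamma (s + d₂ + k))⁻¹ *
          (Complex.Gamma (s + d₃ + k))⁻¹))) := by
    intro k
    have h := integrable_and_integral_kernelSeries (s := s + k) hg hg0 (hre s k hs)
      (by rw [add_right_comm]; exact hre _ k hp) (by rw [add_right_comm]; exact hre _ k hq)
    rw [add_right_comm s k p, add_right_comm s k q, add_right_comm s k d₁, add_right_comm s k d₂,
      add_right_comm s k d₃] at h
    exact h
  have hKs : Integrable (K s) (volume.restrict (Ioo 0 1)) := by simpa using (hshift 0).1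
  have hKpow : ∀ u ∈ Ioo (0 : ℝ) 1, ∀ k : ℕ, K (s + k) u = (u : ℂ) ^ k * K s u := by
    intro u hu k
    have hu0 : (u : ℂ) ≠ 0 := by exact_mod_cast hu.1.ne'
    simp only [hK, betaKernel]
    rw [show s + k - 1 = s - 1 + k by ring, Complex.cpow_add _ _ hu0, Complex.cpow_natCast]
    ring
  have hKpred : ∀ u ∈ Ioo (0 : ℝ) 1, K s u = (u : ℂ) * K (s - 1) u := by
    intro u hu
    have hu0 : (u : ℂ) ≠ 0 := by exact_mod_cast hu.1.ne'
    simp only [hK, betaKernel]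
    rw [show s - 1 = s - 1 - 1 + 1 by ring, Complex.cpow_add _ _ hu0, Complex.cpow_one]
    ring_nf
  set F : ℕ → ℝ → ℂ := fun k u =>
    (-1) ^ k * w ^ (2 * k + 1) / ((2 * k + 1).factorial : ℂ) * K (s + (2 * k : ℕ)) u with hF
  have hint : ∀ k, Integrable (F k) (volume.restrict (Ioo 0 1)) := fun k =>
    (hshift (2 * k)).1.const_mul _
  have hnorm : Summable fun k => ∫ u in Ioo (0 : ℝ) 1, ‖F k u‖ := by
    refine Summable.of_nonneg_of_le (fun k => integral_nonneg fun _ => norm_nonneg _) (fun k => ?_)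
      ((Real.hasSum_sinh ‖w‖).summable.mul_right (∫ u in Ioo (0 : ℝ) 1, ‖K s u‖))
    simp only [hF, norm_mul, norm_div, norm_pow, norm_neg, norm_one, one_pow, one_mul,
      Complex.norm_natCast]
    rw [integral_const_mul]
    refine mul_le_mul_of_nonneg_left (setIntegral_mono_on (hshift _).1.norm hKs.norm
      measurableSet_Ioo fun u hu => ?_) (by positivity)
    rw [hKpow u hu, norm_mul, norm_pow, Complex.norm_real, Real.norm_of_nonneg hu.1.le]
    exact mul_le_of_le_one_left (norm_nonneg _) (pow_le_one₀ hu.1.le hu.2.le)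
  have htsum : ∀ u ∈ Ioo (0 : ℝ) 1, ∑' k, F k u = K (s - 1) u * Complex.sin (w * u) := by
    intro u hu
    rw [Complex.sin_eq_tsum, ← tsum_mul_left]
    refine tsum_congr fun k => ?_
    simp only [hF]
    rw [hKpow u hu, hKpred u hu]
    ring
  have h1 := integrable_tsum_of_summable_integral_norm hint hnorm
  have h2 := hasSum_integral_of_summable_integral_norm hint hnorm
  rw [setIntegral_congr_fun measurableSet_Ioo htsum] at h2
  refine ⟨h1.congr ((ae_restrict_iff' measurableSet_Ioo).2 (ae_of_all _ htsum)), ?_⟩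
  have h3 : ∀ k, ∫ u in Ioo (0 : ℝ) 1, F k u =
      (-1) ^ k * w ^ (2 * k + 1) / ((2 * k + 1).factorial : ℂ) *
        ∫ u in Ioo (0 : ℝ) 1, K (s + (2 * k : ℕ)) u := fun k => integral_const_mul _ _
  simp only [h3, fun k => (hshift (2 * k)).2] at h2
  exact h2

/-- The duplication formula for Pochhammer symbols. -/
theorem poch_two_mul (s : ℂ) (k : ℕ) :
    poch s (2 * k) = 4 ^ k * (poch (s / 2) k * poch ((s + 1) / 2) k) := by
  induction k with
  | zero => simp [poch_zero]
  | succ k ih =>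
    rw [show 2 * (k + 1) = 2 * k + 1 + 1 by ring, poch_succ, poch_succ, ih, poch_succ, poch_succ]
    push_cast; ring

theorem factorial_two_mul_add_one (k : ℕ) :
    ((2 * k + 1).factorial : ℂ) = 4 ^ k * (poch (3 / 2) k * poch 1 k) := by
  induction k with
  | zero => simp [poch_zero]
  | succ k ih =>
    rw [show 2 * (k + 1) + 1 = 2 * k + 1 + 1 + 1 by ring, Nat.factorial_succ, Nat.factorial_succ]
    rw [Nat.cast_mul, Nat.cast_mul, ih, poch_succ, poch_succ]
    push_cast; ring

theorem poch_ne_zero {s : ℂ} (h : ∀ n : ℕ, s ≠ -(n : ℂ)) (k : ℕ) : poch s k ≠ 0 := by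
  rw [poch_eq_prod_range]
  exact Finset.prod_ne_zero_iff.2 fun j _ h0 => h j (eq_neg_of_add_eq_zero_left h0)

theorem inv_Gamma_add_nat {s : ℂ} (h : ∀ n : ℕ, s ≠ -(n : ℂ)) (k : ℕ) :
    (Complex.Gamma (s + k))⁻¹ = (Complex.Gamma s)⁻¹ / poch s k := by
  rw [inv_Gamma_eq_poch_mul s k, mul_div_cancel_left₀ _ (poch_ne_zero h k)]

/-- The `k`-th term of the integrated sine series is that of the `₆F₇` series. -/
theorem gamma_term_eq_hypergeometric_term {s p q d₁ d₂ d₃ w : ℂ} (hs : 0 < s.re)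
    (hp : 0 < (s + p).re) (hq : 0 < (s + q).re) (h₁ : ∀ n : ℕ, s + d₁ ≠ -(n : ℂ))
    (h₂ : ∀ n : ℕ, s + d₂ ≠ -(n : ℂ)) (h₃ : ∀ n : ℕ, s + d₃ ≠ -(n : ℂ)) (k : ℕ) :
    (-1) ^ k * w ^ (2 * k + 1) / ((2 * k + 1).factorial : ℂ) *
      (Complex.Gamma (s + (2 * k : ℕ)) *
        (Complex.Gamma (s + p + (2 * k : ℕ)) * Complex.Gamma (s + q + (2 * k : ℕ)) *
        ((Complex.Gamma (s + d₁ + (2 * k : ℕ)))⁻¹ * (Complex.Gamma (s + d₂ + (2 * k : ℕ)))⁻¹ *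
          (Complex.Gamma (s + d₃ + (2 * k : ℕ)))⁻¹))) =
    w * (Complex.Gamma s * Complex.Gamma (s + p) * Complex.Gamma (s + q) /
      (Complex.Gamma (s + d₁) * Complex.Gamma (s + d₂) * Complex.Gamma (s + d₃))) *
      (poch (s / 2) k * (poch ((s + 1) / 2) k * (poch ((s + p) / 2) k *
        (poch ((s + p + 1) / 2) k * (poch ((s + q) / 2) k * poch ((s + q + 1) / 2) k)))) /
      (poch (3 / 2) k * (poch ((s + d₁) / 2) k * (poch ((s + d₁ + 1) / 2) k *
        (poch ((s + d₂) / 2) k * (poch ((s + d₂ + 1) / 2) k * (poch ((s + d₃) / 2) k *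
          poch ((s + d₃ + 1) / 2) k))))) * poch 1 k) * (-(w ^ 2 / 4)) ^ k) := by
  rw [Gamma_add_nat_of_re_pos hs, Gamma_add_nat_of_re_pos hp, Gamma_add_nat_of_re_pos hq,
    inv_Gamma_add_nat h₁, inv_Gamma_add_nat h₂, inv_Gamma_add_nat h₃, factorial_two_mul_add_one]
  simp only [poch_two_mul]
  rw [neg_pow (w ^ 2 / 4), div_pow, pow_succ, pow_mul]
  have hQ : (4 : ℂ) ^ k ≠ 0 := pow_ne_zero _ (by norm_num)
  -- three of the four powers of `4` cancel; the fourth makes the argument `-w ^ 2 / 4`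
  have hQ3 : ((4 : ℂ) ^ k * ((4 : ℂ) ^ k)⁻¹) ^ 3 = 1 := by rw [mul_inv_cancel₀ hQ, one_pow]
  generalize (4 : ℂ) ^ k = Q at *
  generalize (w ^ 2) ^ k = W
  generalize (-1 : ℂ) ^ k = ε
  generalize poch 1 k = A
  rw [← mul_one (w * _ * _), ← hQ3]
  ring

/-- The sine formula; the one for the hyperbolic sine follows by replacing `c` by `c * I`. -/
theorem msmIntegral_sin (α α' β β' γ ρ c : ℂ) (x : ℝ) (hx : 0 < x) (hγ : 0 < γ.re)
    (hρ : max 0 (max (α + α' + β - γ).re (α' - β').re) < (ρ + 1).re)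
    (h₁ : ∀ n : ℕ, ρ + 1 + β' ≠ -(n : ℂ))
    (h₂ : ∀ n : ℕ, ρ + 1 + γ - α - α' ≠ -(n : ℂ))
    (h₃ : ∀ n : ℕ, ρ + 1 + γ - α' - β ≠ -(n : ℂ)) :
    IntervalIntegrable
        (msmIntegrand α α' β β' γ (fun t : ℝ => (t : ℂ) ^ (ρ - 1) * Complex.sin (c * t)) x)
        volume 0 x ∧
      msmIntegral α α' β β' γ (fun t : ℝ => (t : ℂ) ^ (ρ - 1) * Complex.sin (c * t)) x =
        sineImage α α' β β' γ (ρ + 1) c x (-(c ^ 2 * (x : ℂ) ^ 2 / 4)) := by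
  obtain ⟨p, hp⟩ : ∃ z : ℂ, z = γ - α - α' - β := ⟨_, rfl⟩
  obtain ⟨q, hq⟩ : ∃ z : ℂ, z = β' - α' := ⟨_, rfl⟩
  obtain ⟨d₂, hd₂⟩ : ∃ z : ℂ, z = γ - α - α' := ⟨_, rfl⟩
  obtain ⟨d₃, hd₃⟩ : ∃ z : ℂ, z = γ - α' - β := ⟨_, rfl⟩
  set s : ℂ := ρ + 1 with hs
  have hg : γ = β' + d₂ + d₃ - p - q := by rw [hp, hq, hd₂, hd₃]; ring
  have hα : α = d₃ - p := by rw [hp, hd₃]; ring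
  have hβ : β = d₂ - p := by rw [hp, hd₂]; ring
  have hα' : α' = β' - q := by rw [hq]; ring
  simp only [max_lt_iff] at hρ
  obtain ⟨hs0, hsp, hsq⟩ := hρ
  have hsp' : 0 < (s + p).re := by
    rw [hp]; simp only [Complex.add_re, Complex.sub_re] at hsp ⊢; linarith
  have hsq' : 0 < (s + q).re := by
    rw [hq]; simp only [Complex.add_re, Complex.sub_re] at hsq ⊢; linarith
  have hxc : (x : ℂ) ≠ 0 := by exact_mod_cast hx.ne'
  obtain ⟨hint, hsum⟩ := integrable_and_hasSum_integral_kernelSeries_mul_sin (c * x) hg hγ hs0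
    hsp' hsq'
  set Ψ : ℝ → ℂ := fun u => betaKernel (s - 1) γ u * kernelSeries β' d₂ d₃ p q γ (1 - u) *
    Complex.sin (c * x * u) with hΨ
  -- the integrand after the substitution `t = x u`
  have hintegrand : ∀ t ∈ Ioo (0 : ℝ) x, msmIntegrand α α' β β' γ
      (fun t : ℝ => (t : ℂ) ^ (ρ - 1) * Complex.sin (c * t)) x t =
      (x : ℂ) ^ (γ - 1 - α' + (ρ - 1)) * Ψ (t / x) := by
    intro t ht
    have hu : t / x ∈ Ioo (0 : ℝ) 1 := ⟨div_pos ht.1 hx, (div_lt_one hx).2 ht.2⟩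
    obtain ⟨u, hu', rfl⟩ : ∃ u : ℝ, u ∈ Ioo (0 : ℝ) 1 ∧ t = x * u :=
      ⟨t / x, hu, by field_simp⟩
    have hxu : x * u / x = u := by field_simp
    have hxu' : x / (x * u) = u⁻¹ := by have := hu'.1.ne'; field_simp
    have hu0 : (u : ℂ) ≠ 0 := by exact_mod_cast hu'.1.ne'
    have hF := appellF3_eq_cpow_mul_kernelSeries hg hγ hu'
    rw [← hα, ← hβ, ← hα'] at hF
    have h1u : 0 ≤ 1 - u := by linarith [hu'.2]
    rw [msmIntegrand, hxu, hxu', hF, show x - x * u = x * (1 - u) by ring]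
    simp only [hΨ, betaKernel]
    rw [Complex.ofReal_mul, Complex.mul_cpow_ofReal_nonneg hx.le h1u, Complex.ofReal_mul,
      Complex.mul_cpow_ofReal_nonneg hx.le hu'.1.le, Complex.mul_cpow_ofReal_nonneg hx.le hu'.1.le,
      Complex.cpow_add _ _ hxc, sub_eq_add_neg (γ - 1) α', Complex.cpow_add _ _ hxc,
      show s - 1 - 1 = ρ - 1 by rw [hs]; ring, mul_assoc c]
    have h0 : (u : ℂ) ^ (-α') * (u : ℂ) ^ α' = 1 := by
      rw [← Complex.cpow_add _ _ hu0]; simp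
    push_cast
    linear_combination ((x : ℂ) ^ (γ - 1) * (1 - u : ℂ) ^ (γ - 1) * (x : ℂ) ^ (-α') *
      kernelSeries β' d₂ d₃ p q γ (1 - u) * ((x : ℂ) ^ (ρ - 1) * (u : ℂ) ^ (ρ - 1)) *
      Complex.sin (c * (x * u))) * h0
  have hΨint : IntervalIntegrable Ψ volume 0 1 :=
    (intervalIntegrable_iff_integrableOn_Ioo_of_le zero_le_one).2 hint
  have hΨx : IntervalIntegrable (fun t => Ψ (t / x)) volume 0 x := by
    have h := hΨint.comp_mul_left (c := x⁻¹)
    simpa [div_eq_inv_mul] using h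
  refine ⟨((hΨx.const_mul ((x : ℂ) ^ (γ - 1 - α' + (ρ - 1))))).congr_uIoo fun t ht => ?_, ?_⟩
  · rw [uIoo_of_le hx.le] at ht
    exact (hintegrand t ht).symm
  have hI : ∫ t in (0 : ℝ)..x, msmIntegrand α α' β β' γ
      (fun t : ℝ => (t : ℂ) ^ (ρ - 1) * Complex.sin (c * t)) x t =
      (x : ℂ) ^ (γ - 1 - α' + (ρ - 1)) * (x * ∫ u in Ioo (0 : ℝ) 1, Ψ u) := by
    rw [intervalIntegral.integral_congr_Ioo_of_le hx.le hintegrand,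
      intervalIntegral.integral_const_mul, intervalIntegral.integral_comp_div Ψ hx.ne', zero_div,
      div_self hx.ne', intervalIntegral.integral_of_le zero_le_one, integral_Ioc_eq_integral_Ioo,
      Complex.real_smul]
  have e₁ : s + γ - α - α' - β = s + p := by rw [hp]; ring
  have e₂ : s + β' - α' = s + q := by rw [hq]; ring
  have e₃ : s + γ - α - α' = s + d₂ := by rw [hd₂]; ring
  have e₄ : s + γ - α' - β = s + d₃ := by rw [hd₃]; ring
  rw [e₃] at h₂
  rw [e₄] at h₃
  have hΓ := Complex.Gamma_ne_zero_of_re_pos hγ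
  rw [msmIntegral, hI, ← hsum.tsum_eq, sineImage, e₁, e₂, e₃, e₄, genHypergeometric]
  simp only [List.map_cons, List.map_nil, List.prod_cons, List.prod_nil, mul_one]
  simp only [mul_left_comm _ (Complex.Gamma γ)]
  simp only [gamma_term_eq_hypergeometric_term hs0 hsp' hsq' h₁ h₂ h₃]
  rw [tsum_mul_left, tsum_mul_left, mul_pow]
  have hpow : (x : ℂ) ^ (s - α - α' + γ - 1) =
      (x : ℂ) ^ (-α) * (x : ℂ) ^ (γ - 1 - α' + (ρ - 1)) * x * x := by
    rw [← Complex.cpow_add _ _ hxc, mul_assoc, ← pow_two, ← Complex.cpow_natCast,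
      ← Complex.cpow_add _ _ hxc]
    congr 1
    rw [hs]; push_cast; ring
  rw [hpow]
  generalize Complex.Gamma s * _ * _ / _ = R
  rw [div_mul_eq_mul_div, div_eq_iff hΓ]
  ring

theorem mainTheorem11 (α α' β β' γ ρ c : ℂ) (x : ℝ) (hx : 0 < x) (hγ : 0 < γ.re)
    (hρ : max 0 (max (α + α' + β - γ).re (α' - β').re) < (ρ + 1).re)
    (h₁ : ∀ n : ℕ, ρ + 1 + β' ≠ -(n : ℂ))
    (h₂ : ∀ n : ℕ, ρ + 1 + γ - α - α' ≠ -(n : ℂ))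
    (h₃ : ∀ n : ℕ, ρ + 1 + γ - α' - β ≠ -(n : ℂ)) :
    (IntervalIntegrable
        (msmIntegrand α α' β β' γ (fun t : ℝ => (t : ℂ) ^ (ρ - 1) * Complex.sin (c * t)) x)
        volume 0 x ∧
      msmIntegral α α' β β' γ (fun t : ℝ => (t : ℂ) ^ (ρ - 1) * Complex.sin (c * t)) x =
        sineImage α α' β β' γ (ρ + 1) c x (-(c ^ 2 * (x : ℂ) ^ 2 / 4))) ∧
    (IntervalIntegrable
        (msmIntegrand α α' β β' γ (fun t : ℝ => (t : ℂ) ^ (ρ - 1) * Complex.sinh (c * t)) x)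
        volume 0 x ∧
      msmIntegral α α' β β' γ (fun t : ℝ => (t : ℂ) ^ (ρ - 1) * Complex.sinh (c * t)) x =
        sineImage α α' β β' γ (ρ + 1) c x (c ^ 2 * (x : ℂ) ^ 2 / 4)) := by
  refine ⟨msmIntegral_sin α α' β β' γ ρ c x hx hγ hρ h₁ h₂ h₃, ?_⟩
  obtain ⟨hi, hv⟩ := msmIntegral_sin α α' β β' γ ρ (c * Complex.I) x hx hγ hρ h₁ h₂ h₃
  have hfun : ∀ t : ℝ, msmIntegrand α α' β β' γ
      (fun t : ℝ => (t : ℂ) ^ (ρ - 1) * Complex.sinh (c * t)) x t = -Complex.I *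
      msmIntegrand α α' β β' γ
        (fun t : ℝ => (t : ℂ) ^ (ρ - 1) * Complex.sin (c * Complex.I * t)) x t := by
    intro t
    simp only [msmIntegrand]
    rw [mul_right_comm c Complex.I, Complex.sin_mul_I]
    linear_combination ((((x - t : ℝ) : ℂ) ^ (γ - 1) * (t : ℂ) ^ (-α') *
      appellF3 α α' β β' γ ((1 - t / x : ℝ) : ℂ) ((1 - x / t : ℝ) : ℂ) *
      ((t : ℂ) ^ (ρ - 1) * Complex.sinh (c * t)))) * Complex.I_sq
  have hz : -((c * Complex.I) ^ 2 * (x : ℂ) ^ 2 / 4) = c ^ 2 * (x : ℂ) ^ 2 / 4 := by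
    rw [mul_pow, Complex.I_sq]; ring
  rw [hz] at hv
  refine ⟨(hi.const_mul (-Complex.I)).congr fun t _ => (hfun t).symm, ?_⟩
  rw [msmIntegral] at hv ⊢
  rw [intervalIntegral.integral_congr fun t _ => hfun t, intervalIntegral.integral_const_mul,
    mul_left_comm, hv, sineImage, sineImage]
  linear_combination (-(c * (Complex.Gamma (ρ + 1) * Complex.Gamma (ρ + 1 + γ - α - α' - β) *
    Complex.Gamma (ρ + 1 + β' - α') / (Complex.Gamma (ρ + 1 + β') *
      Complex.Gamma (ρ + 1 + γ - α - α') * Complex.Gamma (ρ + 1 + γ - α' - β))) *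
    (x : ℂ) ^ (ρ + 1 - α - α' + γ - 1) * genHypergeometric
      [(ρ + 1) / 2, (ρ + 1 + 1) / 2,
        (ρ + 1 + γ - α - α' - β) / 2, (ρ + 1 + γ - α - α' - β + 1) / 2,
        (ρ + 1 + β' - α') / 2, (ρ + 1 + β' - α' + 1) / 2]
      [3 / 2,
        (ρ + 1 + β') / 2, (ρ + 1 + β' + 1) / 2,
        (ρ + 1 + γ - α - α') / 2, (ρ + 1 + γ - α - α' + 1) / 2,
        (ρ + 1 + γ - α' - β) / 2, (ρ + 1 + γ - α' - β + 1) / 2] (c ^ 2 * (x : ℂ) ^ 2 / 4))) *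
    Complex.I_sq
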